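/- **Notation.** For a real matrix $A$ let $\mathrm{st}(A)=\|A\|_F^2/\|A\|_{\mathrm{op}}^2$ (stable rank; $\mathrm{st}(0):=0$). For $X=[x_1,\dots,x_n]\in\mathbf R^{d\times n}$ let $\mathrm{RMSNorm}(X)$ be the matrix with columns $\sqrt d\,x_t/\|x_t\|_2$. **Transformer at Gaussian initialization.** Let $L,n_{\mathrm{head}},d,k,n\ge 1$ be integers with $n_{\mathrm{head}}\mid d$, and $d_{\mathrm{head}}=d/n_{\mathrm{head}}$. Let $(i_1,\dots,i_n)\in\{1,\dots,V\}^n$ be a fixed token sequence and $p_{\max}=\max_j \frac1n|\{t: i_t=j\}|$. Let $E=[e_1,\dots,e_V]\in\mathbf R^{d\times V}$ have i.i.d. $\mathcal N(0,1)$ entries, and let $X^{(0)}\in\mathbf R^{d\times n}$ have columns $x^{(0)}_t=e_{i_t}$. For $\ell=0,\dots,L-1$ and $h\in\{1,\dots,n_{\mathrm{head}}\}$ let $W_V^{(h,\ell)}\in\mathbf R^{d_{\mathrm{head}}\times d}$ and $W_O^{(\ell)}\in\mathbf R^{d\times d}$ have $\mathcal N(0,1/d)$ entries and $W_2^{(\ell)}\in\mathbf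 R^{d\times k}$ have $\mathcal N(0,1/k)$ entries, all entries of $E$ and of all these matrices being mutually independent. Let $P^{(h,\ell)}\in\mathbf R^{n\times n}$ be random matrices whose columns are probability vectors, let $B^{(\ell)}=[b^{(\ell)}_1,\dots,b^{(\ell)}_n]\in\mathbf R^{k\times n}$ be random matrices, and define $$A^{\mathrm{rms},(\ell)}=\mathrm{RMSNorm}(X^{(\ell)}),\qquad H^{(\ell)}=\mathrm{Concat}_h\bigl(W_V^{(h,\ell)}A^{\mathrm{rms},(\ell)}P^{(h,\ell)}\bigr),\qquad X^{\mathrm{att},(\ell)}=X^{(\ell)}+W_O^{(\ell)}H^{(\ell)},$$ $$A^{\mathrm{rms},(\ell)}_{\mathrm{mlp}}=\mathrm{RMSNorm}(X^{\mathrm{att},(\ell)}),\qquad X^{(\ell+1)}=X^{\mathrm{att},(\ell)}+W_2^{(\ell)}B^{(\ell)},\qquad A^{\mathrm{rms}}_{\mathrm{final}}=\mathrm{RMSNorm}(X^{(L)}),$$ where $\mathrm{Concat}_h$ stacks the $n_{\mathrm{head}}$ blocks vertically. Assume that for each $\ell$ the pair $\bigl(X^{(\ell)},(P^{(h,\ell)})_h\bigr)$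 is independent of $\bigl((W_V^{(h,\ell)})_h,W_O^{(\ell)},W_2^{(\ell)}\bigr)$, and the pair $(X^{\mathrm{att},(\ell)},B^{(\ell)})$ is independent of $W_2^{(\ell)}$. **Propagation interface.** Let $C_{\mathrm{PROP}}\ge 1$, $m_*\ge 0$ and $P_{\mathrm{PROP}}\in[0,1]$ be such that for each $\ell=0,\dots,L-1$, with probability at least $P_{\mathrm{PROP}}$, $$\mathrm{st}(B^{(\ell)})\le C_{\mathrm{PROP}}\,\mathrm{st}\bigl(A^{\mathrm{rms},(\ell)}_{\mathrm{mlp}}\bigr)\quad\text{and}\quad \|b^{(\ell)}_t\|_2^2\le m_*k\ \text{ for all } t.$$ **Theorem.** Set $\rho:=3.1(1+m_*)$. There exist numerical constants $c,C>0$ (depending on nothing) such that in the above setting, whenever $d\ge CL^2\log(nL)$ and $k\ge CL^2\log(nL)$, with probability at least $$1-CL\exp\!\Bigl(-c\,\frac d{L^2}\Bigr)-L\,(1-P_{\mathrm{PROP}})$$ all of the following hold simultaneously: (i) $\mathrm{st}(X^{(0)})\le \dfrac{1.01}{p_{\max}}$, $\ \mathrm{st}(A^{\mathrm{rms},(0)})\le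 \dfrac{1.03}{p_{\max}}$, $\ \mathrm{st}(A^{\mathrm{rms},(0)}_{\mathrm{mlp}})\le \dfrac{6.03}{p_{\max}}$; (ii) for every $\ell=0,\dots,L-1$, $$\mathrm{st}(A^{\mathrm{rms},(\ell)})\le \bigl(1.02+1.02(1+m_*)\ell\bigr)\frac{1.01}{p_{\max}}\rho^\ell,\qquad \mathrm{st}(A^{\mathrm{rms},(\ell)}_{\mathrm{mlp}})\le \bigl(6.13+3.09(1+m_*)\ell\bigr)\frac{1.01}{p_{\max}}\rho^\ell,$$ $$\mathrm{st}(B^{(\ell)})\le C_{\mathrm{PROP}}\bigl(6.13+3.09(1+m_*)\ell\bigr)\frac{1.01}{p_{\max}}\rho^\ell,$$ and $$\mathrm{st}(A^{\mathrm{rms}}_{\mathrm{final}})\le \bigl(1.02+1.02(1+m_*)L\bigr)\frac{1.01}{p_{\max}}\rho^L.$$ -/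

import Mathlib

open MeasureTheory ProbabilityTheory

noncomputable section

namespace StableRank

/-- The spectral norm of a real matrix: its operator norm with respect to Euclidean norms. -/
def opNorm {d n : ℕ} (A : Matrix (Fin d) (Fin n) ℝ) : ℝ :=
  ‖(Matrix.toEuclideanLin A).toContinuousLinearMap‖

/-- The squared Frobenius norm. -/
def frobSq {d n : ℕ} (A : Matrix (Fin d) (Fin n) ℝ) : ℝ :=
  ∑ i, ∑ j, A i j ^ 2

/-- The stable rank `‖A‖_F² / ‖A‖_op²`. -/
def stableRank {d n : ℕ} (A : Matrix (Fin d) (Fin n) ℝ) : ℝ :=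
  frobSq A / opNorm A ^ 2

/-- The squared Euclidean norm of the `t`-th column. -/
def colNormSq {d n : ℕ} (A : Matrix (Fin d) (Fin n) ℝ) (t : Fin n) : ℝ :=
  ∑ i, A i t ^ 2

/-- RMS normalization: every column `x_t` is replaced by `√d · x_t / ‖x_t‖₂`. -/
def rmsNorm {d n : ℕ} (X : Matrix (Fin d) (Fin n) ℝ) : Matrix (Fin d) (Fin n) ℝ :=
  fun i t => √(d : ℝ) * (X i t / √(colNormSq X t))

/-- Vertical stacking of `nHead` blocks of height `d / nHead` into a matrix with `d` rows. -/
def concatHeads {d nHead n : ℕ} (hdvd : nHead ∣ d)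
    (H : Fin nHead → Matrix (Fin (d / nHead)) (Fin n) ℝ) : Matrix (Fin d) (Fin n) ℝ :=
  fun i t =>
    let q : Fin nHead × Fin (d / nHead) :=
      finProdFinEquiv.symm (Fin.cast (Nat.mul_div_cancel' hdvd).symm i)
    H q.1 q.2 t

/-- Empirical frequency of the most common token of the sequence `tok`. -/
def pMax {n V : ℕ} (tok : Fin n → Fin V) : ℝ :=
  ⨆ j : Fin V, ((Finset.univ.filter fun t => tok t = j).card : ℝ) / n

/-- The ingredients of a transformer with vocabulary size `V`, width `d`, `nHead` heads, MLP
width `k`, on a token sequence of length `n`: the tokens, and the random matrices on the sample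
space `Ω`. Layers are indexed by `ℕ`; only the layers `ℓ < L` are ever used for depth `L`. -/
structure Transformer (Ω : Type*) (V d nHead k n : ℕ) where
  /-- The number of heads divides the width. -/
  head_dvd : nHead ∣ d
  /-- The (deterministic) token sequence. -/
  tok : Fin n → Fin V
  /-- Embedding matrix. -/
  E : Ω → Matrix (Fin d) (Fin V) ℝ
  /-- Attention mixing matrices. -/
  P : ℕ → Fin nHead → Ω → Matrix (Fin n) (Fin n) ℝ
  /-- Value projections. -/
  WV : ℕ → Fin nHead → Ω → Matrix (Fin (d / nHead)) (Fin d) ℝ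
  /-- Output projections. -/
  WO : ℕ → Ω → Matrix (Fin d) (Fin d) ℝ
  /-- MLP output weights. -/
  W2 : ℕ → Ω → Matrix (Fin d) (Fin k) ℝ
  /-- MLP post-activations. -/
  B : ℕ → Ω → Matrix (Fin k) (Fin n) ℝ

/-- Indices of the scalar Gaussian weights of the first `L` layers and of the embedding. -/
inductive WeightIdx (L V d nHead k : ℕ) : Type
  | embed (i : Fin d) (j : Fin V)
  | value (ℓ : Fin L) (h : Fin nHead) (i : Fin (d / nHead)) (j : Fin d)
  | out (ℓ : Fin L) (i : Fin d) (j : Fin d)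
  | mlp (ℓ : Fin L) (i : Fin d) (j : Fin k)

/-- Variances: `1` for the embedding, the inverse input dimension for all other weights. -/
def weightVar {L V d nHead k : ℕ} : WeightIdx L V d nHead k → NNReal
  | .embed _ _ => 1
  | .value _ _ _ _ => (d : NNReal)⁻¹
  | .out _ _ _ => (d : NNReal)⁻¹
  | .mlp _ _ _ => (k : NNReal)⁻¹

namespace Transformer

variable {Ω : Type*} {V d nHead k n : ℕ} (T : Transformer Ω V d nHead k n)

/-- The embedding matrix `X⁽⁰⁾` of the token sequence; its `t`-th column is `e_{i_t}`. -/
def embedded (ω : Ω) : Matrix (Fin d) (Fin n) ℝ :=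
  fun i t => T.E ω i (T.tok t)

/-- The attention sublayer `X ↦ X + W_O · Concat_h (W_V⁽ʰ⁾ · RMSNorm(X) · P⁽ʰ⁾)` of layer `ℓ`. -/
def attention (ℓ : ℕ) (ω : Ω) (X : Matrix (Fin d) (Fin n) ℝ) : Matrix (Fin d) (Fin n) ℝ :=
  X + T.WO ℓ ω * concatHeads T.head_dvd fun h => T.WV ℓ h ω * (rmsNorm X * T.P ℓ h ω)

/-- The hidden states `X⁽ˡ⁾`. -/
def hidden : ℕ → Ω → Matrix (Fin d) (Fin n) ℝ
  | 0, ω => T.embedded ω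
  | ℓ + 1, ω => T.attention ℓ ω (hidden ℓ ω) + T.W2 ℓ ω * T.B ℓ ω

/-- The attention output `X^{att,(ℓ)}`. -/
def hiddenAtt (ℓ : ℕ) (ω : Ω) : Matrix (Fin d) (Fin n) ℝ :=
  T.attention ℓ ω (T.hidden ℓ ω)

/-- `A^{rms,(ℓ)}`; for `ℓ = L` this is `A^{rms}_{final}`. -/
def rms (ℓ : ℕ) (ω : Ω) : Matrix (Fin d) (Fin n) ℝ :=
  rmsNorm (T.hidden ℓ ω)

/-- `A^{rms,(ℓ)}_{mlp}`. -/
def rmsMlp (ℓ : ℕ) (ω : Ω) : Matrix (Fin d) (Fin n) ℝ :=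
  rmsNorm (T.hiddenAtt ℓ ω)

/-- The scalar weights as real random variables. -/
def weight {L : ℕ} : WeightIdx L V d nHead k → Ω → ℝ
  | .embed i j => fun ω => T.E ω i j
  | .value ℓ h i j => fun ω => T.WV ℓ h ω i j
  | .out ℓ i j => fun ω => T.WO ℓ ω i j
  | .mlp ℓ i j => fun ω => T.W2 ℓ ω i j

/-- The first `L` layers are at Gaussian initialization. -/
structure GaussianInit [MeasurableSpace Ω] (μ : Measure Ω) (L : ℕ) : Prop where
  measurable_weight : ∀ w : WeightIdx L V d nHead k, Measurable (T.weight w)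
  measurable_P : ∀ ℓ < L, ∀ h i t, Measurable fun ω => T.P ℓ h ω i t
  measurable_B : ∀ ℓ < L, ∀ i t, Measurable fun ω => T.B ℓ ω i t
  /-- All weights are mutually independent. -/
  indep : iIndepFun (fun w : WeightIdx L V d nHead k => T.weight w) μ
  /-- All weights are centered Gaussians with the prescribed variances. -/
  law : ∀ w : WeightIdx L V d nHead k, μ.map (T.weight w) = gaussianReal 0 (weightVar w)
  /-- The columns of the mixing matrices are probability vectors. -/
  stochastic : ∀ ℓ < L, ∀ h ω t, (fun i => T.P ℓ h ω i t) ∈ stdSimplex ℝ (Fin n)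
  /-- At each layer the mixing matrices, together with the block input they act on, are
  independent of the Gaussian weights of that layer. -/
  indep_P : ∀ ℓ < L,
    IndepFun
      (fun ω => ((fun i t => T.hidden ℓ ω i t, fun h i t => T.P ℓ h ω i t) :
        (Fin d → Fin n → ℝ) × (Fin nHead → Fin n → Fin n → ℝ)))
      (fun ω => ((fun h i j => T.WV ℓ h ω i j, fun i j => T.WO ℓ ω i j,
          fun i j => T.W2 ℓ ω i j) :
        (Fin nHead → Fin (d / nHead) → Fin d → ℝ) × (Fin d → Fin d → ℝ) ×
          (Fin d → Fin k → ℝ))) μ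
  /-- At each layer the MLP post-activation, together with the residual input to which
  `W₂ B` is added, is independent of `W₂`. -/
  indep_B : ∀ ℓ < L,
    IndepFun
      (fun ω => ((fun i t => T.hiddenAtt ℓ ω i t, fun i t => T.B ℓ ω i t) :
        (Fin d → Fin n → ℝ) × (Fin k → Fin n → ℝ)))
      (fun ω => ((fun i j => T.W2 ℓ ω i j) : Fin d → Fin k → ℝ)) μ

end Transformer

/-- The propagation interface for a random intermediate `B` fed by the input `X`: with
probability at least `p`, `st(B) ≤ Cprop · st(RMSNorm X)` and all squared column norms of `B`
are at most `m * k`. -/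
structure PropagationInterface {Ω : Type*} [MeasurableSpace Ω] (μ : Measure Ω) {d k n : ℕ}
    (X : Ω → Matrix (Fin d) (Fin n) ℝ) (B : Ω → Matrix (Fin k) (Fin n) ℝ)
    (Cprop m p : ℝ) : Prop where
  one_le_Cprop : 1 ≤ Cprop
  m_nonneg : 0 ≤ m
  p_nonneg : 0 ≤ p
  p_le_one : p ≤ 1
  prob : p ≤ μ.real {ω | stableRank (B ω) ≤ Cprop * stableRank (rmsNorm (X ω)) ∧
    ∀ t, colNormSq (B ω) t ≤ m * k}

end StableRank

end

namespace StableRank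

/-! ### Exponential moments of the square of a Gaussian -/

/-! One test vector serves every layer: the indicator `u` of the positions of a most frequent token
`j`. With `s = n * pMax`, `‖u‖² = s`, and the selected columns of `X⁽⁰⁾` all equal `e_j`, so `X⁽⁰⁾ u
= s e_j` has squared norm about `s² d`. RMS normalization only rescales columns, so if all squared
column norms of `X` are at most `R`, then `st(RMSNorm X) ≤ n R ‖u‖² / ‖X u‖²`
(`stableRank_rmsNorm_le`). It remains to bound column norms above and `‖X u‖²` below.

Both sublayers have the form `X ↦ X + G M`, with `G` Gaussian and independent of `(X, M)`.
Conditionally, `x + G b` has independent Gaussian coordinates, and its squared norm concentrates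
around `‖x‖²` plus a nonnegative variance term. Hence `‖X u‖²` loses at most a factor `q = 1 - ε`
per sublayer, while squared column norms gain at most `d` (attention) or `m d` (MLP), again up to
powers of `q`. After `ℓ` layers this gives `st ≤ (1 + (1 + m) ℓ) / pMax` up to at most `7L` powers
of `q` (`stableRank_bounds_of_typical`). Taking `ε = 1/(1000 L)` keeps that loss below `1.01`.

Each concentration event fails with probability at most `exp (-ε² d / 16)`. There are of order `n L`
of them, and the assumption `d ≥ C L² log (n L)` absorbs this count. -/

lemma neg_log_one_sub_le {x : ℝ} (hx : |x| ≤ 1 / 2) : -Real.log (1 - x) ≤ x + x ^ 2 := by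
  obtain ⟨h1, h2⟩ := abs_le.1 hx
  -- For `x ≤ 0` the first-order bound on `exp` suffices, as `(1 - x)(1 + x + x²) = 1 - x³`; for `x
  -- ≥ 0` the second-order term is needed.
  have h : 1 ≤ (1 - x) * Real.exp (x + x ^ 2) := by
    rcases le_total x 0 with h0 | h0
    · have h3 : 0 ≤ -x ^ 3 := by nlinarith [mul_nonneg (neg_nonneg.2 h0) (sq_nonneg x)]
      nlinarith [mul_le_mul_of_nonneg_left (Real.add_one_le_exp (x + x ^ 2))
        (by linarith : 0 ≤ 1 - x)]
    · have h3 := mul_le_mul_of_nonneg_left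
        (Real.quadratic_le_exp_of_nonneg (by positivity : 0 ≤ x + x ^ 2))
        (by linarith : 0 ≤ 1 - x)
      have h4 : 0 ≤ x ^ 2 * ((1 - x) * (1 + x) ^ 2 / 2 - x) :=
        mul_nonneg (sq_nonneg x) (by nlinarith [mul_nonneg h0 (sub_nonneg.2 h2), pow_nonneg h0 3])
      linarith
  rw [neg_le_iff_add_nonneg, ← Real.log_exp (x + x ^ 2),
    ← Real.log_mul (Real.exp_pos _).ne' (by linarith)]
  exact Real.log_nonneg (by linarith)

/-- Completing the square in the Gaussian density. -/
lemma exp_sq_mul_gaussianPDFReal {a l : ℝ} {v w : NNReal} (hv : v ≠ 0)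
    (hl : 0 < 1 - 2 * l * v) (hw : (w : ℝ) = v / (1 - 2 * l * v)) (x : ℝ) :
    Real.exp (l * x ^ 2) * gaussianPDFReal a v x =
      (√(1 - 2 * l * v))⁻¹ * Real.exp (l * a ^ 2 / (1 - 2 * l * v)) *
        gaussianPDFReal (a / (1 - 2 * l * v)) w x := by
  have hv' : (v : ℝ) ≠ 0 := by exact_mod_cast hv
  set q := 1 - 2 * l * v with hq
  have hq0 : q ≠ 0 := hl.ne'
  have hs : (√(2 * Real.pi * w))⁻¹ = √q * (√(2 * Real.pi * v))⁻¹ := by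
    rw [hw, ← mul_div_assoc, Real.sqrt_div' _ hl.le, inv_div, div_eq_mul_inv]
  have he : Real.exp (l * x ^ 2) * Real.exp (-(x - a) ^ 2 / (2 * v)) =
      Real.exp (l * a ^ 2 / q) * Real.exp (-(x - a / q) ^ 2 / (2 * w)) := by
    rw [← Real.exp_add, ← Real.exp_add, hw]
    congr 1
    have hl' : l = (1 - q) / (2 * v) := by rw [hq]; field_simp; ring
    rw [hl']
    field_simp
    ring
  rw [gaussianPDFReal, gaussianPDFReal, hs]
  have hsq : √q ≠ 0 := (Real.sqrt_pos.2 hl).ne'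
  calc _ = (√(2 * Real.pi * v))⁻¹ *
        (Real.exp (l * x ^ 2) * Real.exp (-(x - a) ^ 2 / (2 * v))) := by ring
    _ = _ := by rw [he]; field_simp

lemma integrable_exp_mul_sq_gaussianReal {a l : ℝ} {v : NNReal} (hl : 4 * |l| * v ≤ 1) :
    Integrable (fun x => Real.exp (l * x ^ 2)) (gaussianReal a v) := by
  rcases eq_or_ne v 0 with rfl | hv
  · rw [gaussianReal_zero_var]
    exact integrable_dirac (by simp)
  have h1 : 0 < 1 - 2 * l * v := by
    linarith [mul_le_mul_of_nonneg_right (le_abs_self l) v.coe_nonneg]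
  rw [gaussianReal_of_var_ne_zero _ hv,
    integrable_withDensity_iff (measurable_gaussianPDF _ _) (ae_of_all _ fun _ => gaussianPDF_lt_top)]
  simp_rw [toReal_gaussianPDF]
  obtain ⟨w, hw⟩ : ∃ w : NNReal, (w : ℝ) = v / (1 - 2 * l * v) :=
    ⟨⟨v / (1 - 2 * l * v), by positivity⟩, rfl⟩
  simp_rw [exp_sq_mul_gaussianPDFReal hv h1 hw]
  exact (integrable_gaussianPDFReal _ _).const_mul _

/-- Completing the square gives the exact value `(1 - 2lv)^(-1/2) exp (l a² / (1 - 2lv))`. The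
condition on `l` keeps `1 - 2lv ≥ 1/2`, so expanding the exponent leaves the mean term and a
quadratic error. -/
lemma integral_exp_mul_sq_gaussianReal_le {a l : ℝ} {v : NNReal} (hl : 4 * |l| * v ≤ 1) :
    ∫ x, Real.exp (l * x ^ 2) ∂(gaussianReal a v) ≤
      Real.exp (l * (a ^ 2 + v) + 4 * l ^ 2 * v * (a ^ 2 + v)) := by
  rcases eq_or_ne v 0 with rfl | hv
  · rw [gaussianReal_zero_var]
    simp
  have hx : |2 * l * v| ≤ 1 / 2 := by
    rw [abs_mul, abs_mul, abs_two, NNReal.abs_eq]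
    linarith
  have h1 : 0 < 1 - 2 * l * v := by linarith [(abs_le.1 hx).2]
  have hv0 : 0 < v := pos_iff_ne_zero.2 hv
  obtain ⟨w, hw⟩ : ∃ w : NNReal, (w : ℝ) = v / (1 - 2 * l * v) :=
    ⟨⟨v / (1 - 2 * l * v), by positivity⟩, rfl⟩
  rw [integral_gaussianReal_eq_integral_smul hv]
  simp_rw [smul_eq_mul, mul_comm (gaussianPDFReal a v _), exp_sq_mul_gaussianPDFReal hv h1 hw]
  rw [integral_const_mul, integral_gaussianPDFReal_eq_one, mul_one]
  swap
  · rw [← NNReal.coe_ne_zero, hw]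
    positivity
  have hs : (√(1 - 2 * l * v))⁻¹ = Real.exp (-Real.log (1 - 2 * l * v) / 2) := by
    rw [Real.sqrt_eq_rpow, Real.rpow_def_of_pos h1, ← Real.exp_neg]
    congr 1
    ring
  rw [hs, ← Real.exp_add, Real.exp_le_exp]
  have hlog := neg_log_one_sub_le hx
  have h2 : l * a ^ 2 / (1 - 2 * l * v) ≤ l * a ^ 2 + 4 * l ^ 2 * v * a ^ 2 := by
    rw [div_le_iff₀ h1]
    have h3 : 0 ≤ l ^ 2 * v * a ^ 2 := by positivity
    nlinarith [mul_le_mul_of_nonneg_left (abs_le.1 hx).2 h3]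
  nlinarith [sq_nonneg (l * v)]

/-! ### Concentration of the squared norm of a Gaussian vector -/

variable {Ω : Type*} [MeasurableSpace Ω] {μ : Measure Ω}

lemma integrable_exp_mul_sq_of_map_eq {Y : Ω → ℝ} (hY : Measurable Y) {a l : ℝ} {v : NNReal}
    (hlaw : μ.map Y = gaussianReal a v) (hl : 4 * |l| * v ≤ 1) :
    Integrable (fun ω => Real.exp (l * Y ω ^ 2)) μ := by
  have h := integrable_exp_mul_sq_gaussianReal (a := a) hl
  rw [← hlaw] at h
  exact h.comp_measurable hY

lemma mgf_sq_le_of_map_eq {Y : Ω → ℝ} (hY : Measurable Y) {a l : ℝ} {v : NNReal}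
    (hlaw : μ.map Y = gaussianReal a v) (hl : 4 * |l| * v ≤ 1) :
    mgf (fun ω => Y ω ^ 2) μ l ≤
      Real.exp (l * (a ^ 2 + v) + 4 * l ^ 2 * v * (a ^ 2 + v)) := by
  refine le_trans (le_of_eq ?_) (integral_exp_mul_sq_gaussianReal_le hl)
  rw [← hlaw, integral_map hY.aemeasurable (by fun_prop), mgf]

section NormSq

variable [IsProbabilityMeasure μ] {ι : Type*} [Fintype ι] {Y : ι → Ω → ℝ} {a : ι → ℝ}
  {v : ι → NNReal} {ε N : ℝ}

lemma mgf_sum_sq_le (hY : ∀ i, Measurable (Y i)) (hind : iIndepFun Y μ)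
    (hlaw : ∀ i, μ.map (Y i) = gaussianReal (a i) (v i)) {l s : ℝ} (hs : ∀ i, (v i : ℝ) ≤ s)
    (hl : 4 * |l| * s ≤ 1) :
    Integrable (fun ω => Real.exp (l * ∑ i, Y i ω ^ 2)) μ ∧
    mgf (fun ω => ∑ i, Y i ω ^ 2) μ l ≤
      Real.exp ((l + 4 * l ^ 2 * s) * ∑ i, (a i ^ 2 + v i)) := by
  have hl' : ∀ i, 4 * |l| * v i ≤ 1 := fun i =>
    (mul_le_mul_of_nonneg_left (hs i) (by positivity)).trans hl
  have hind2 : iIndepFun (fun i ω => Y i ω ^ 2) μ :=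
    hind.comp (fun _ x => x ^ 2) (fun _ => by fun_prop)
  have hfun : (fun ω => ∑ i, Y i ω ^ 2) = ∑ i, fun ω => Y i ω ^ 2 := by ext; simp
  constructor
  · have := hind2.integrable_exp_mul_sum (t := l) (fun i => by fun_prop) (s := Finset.univ)
      (fun i _ => integrable_exp_mul_sq_of_map_eq (hY i) (hlaw i) (hl' i))
    simpa using this
  · rw [hfun, hind2.mgf_sum (fun i => by fun_prop), Finset.mul_sum, Real.exp_sum]
    refine Finset.prod_le_prod (fun i _ => mgf_nonneg) fun i _ =>
      (mgf_sq_le_of_map_eq (hY i) (hlaw i) (hl' i)).trans (Real.exp_le_exp.2 ?_)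
    have h1 : 4 * l ^ 2 * (a i ^ 2 + v i) * v i ≤ 4 * l ^ 2 * (a i ^ 2 + v i) * s :=
      mul_le_mul_of_nonneg_left (hs i) (by positivity)
    linarith

/-- Upper tail of the squared norm of a Gaussian vector with independent coordinates. -/
lemma measure_lt_sum_sq_le (hY : ∀ i, Measurable (Y i)) (hind : iIndepFun Y μ)
    (hlaw : ∀ i, μ.map (Y i) = gaussianReal (a i) (v i)) (hε0 : 0 ≤ ε) (hε1 : ε ≤ 1)
    (hN : ∑ i, (a i ^ 2 + v i) ≤ N) (hv : ∀ i, (v i : ℝ) * Fintype.card ι ≤ N) :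
    μ.real {ω | (1 + ε) * N < ∑ i, Y i ω ^ 2} ≤
      Real.exp (-(ε ^ 2 * Fintype.card ι / 16)) := by
  have hnn : ∀ i ∈ Finset.univ, 0 ≤ a i ^ 2 + (v i : ℝ) := fun i _ => by positivity
  have hN0 : 0 ≤ N := (Finset.sum_nonneg hnn).trans hN
  rcases isEmpty_or_nonempty ι with hι | hι
  · simp
  have hd : (0 : ℝ) < Fintype.card ι := by exact_mod_cast Fintype.card_pos
  set d : ℝ := (Fintype.card ι : ℝ)
  -- If `N = 0`, every mean and variance vanishes, so the sum of squares is almost surely zero.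
  rcases hN0.eq_or_lt with h0 | h0
  · have hz := (Finset.sum_eq_zero_iff_of_nonneg hnn).1
      (le_antisymm (hN.trans h0.ge) (Finset.sum_nonneg hnn))
    have hae : ∀ᵐ ω ∂μ, ∀ i, Y i ω = 0 := by
      rw [ae_all_iff]
      intro i
      have hi := hz i (Finset.mem_univ i)
      have ha : a i = 0 := by
        have : a i ^ 2 = 0 := by nlinarith [sq_nonneg (a i), (v i).coe_nonneg]
        simpa using this
      have hvi : v i = 0 := by
        rw [ha] at hi
        simpa using hi
      have h1 := hlaw i
      rw [ha, hvi, gaussianReal_zero_var] at h1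
      have h2 : ∀ᵐ x ∂(μ.map (Y i)), x = 0 := by
        rw [h1, ae_dirac_eq]
        simp
      exact ae_of_ae_map (hY i).aemeasurable h2
    have hnull : μ {ω | (1 + ε) * N < ∑ i, Y i ω ^ 2} = 0 := by
      rw [measure_eq_zero_iff_ae_notMem]
      filter_upwards [hae] with ω hω
      simp [hω, ← h0]
    rw [measureReal_def, hnull]
    simpa using (Real.exp_pos _).le
  -- Chernoff parameter: the total exponent is at most `-l (1 + ε) N + l (1 + ε/2) N = -l ε N / 2 =
  -- -ε² d / 16`.
  set l : ℝ := ε * d / (8 * N) with hl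
  have hl0 : 0 ≤ l := by positivity
  have hls : l * (N / d) = ε / 8 := by rw [hl]; field_simp
  obtain ⟨hint, hmgf⟩ := mgf_sum_sq_le hY hind hlaw (l := l) (s := N / d)
    (fun i => (le_div_iff₀ hd).2 (hv i)) (by rw [abs_of_nonneg hl0]; nlinarith)
  calc μ.real {ω | (1 + ε) * N < ∑ i, Y i ω ^ 2}
      ≤ μ.real {ω | (1 + ε) * N ≤ ∑ i, Y i ω ^ 2} :=
        measureReal_mono fun ω hω => by
          simp only [Set.mem_ofPred_eq] at hω ⊢
          exact hω.le
    _ ≤ _ := measure_ge_le_exp_mul_mgf _ hl0 hint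
    _ ≤ _ := mul_le_mul_of_nonneg_left hmgf (Real.exp_pos _).le
    _ ≤ _ := by
      rw [← Real.exp_add, Real.exp_le_exp]
      have h1 : l + 4 * l ^ 2 * (N / d) = l * (1 + ε / 2) := by
        rw [show 4 * l ^ 2 * (N / d) = 4 * l * (l * (N / d)) by ring, hls]; ring
      rw [h1]
      have h2 := mul_le_mul_of_nonneg_left hN (by positivity : 0 ≤ l * (1 + ε / 2))
      have h3 : l * N = ε * d / 8 := by rw [hl]; field_simp
      nlinarith

/-- Lower tail of the squared norm of a Gaussian vector with independent coordinates. -/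
lemma measure_sum_sq_lt_le (hY : ∀ i, Measurable (Y i)) (hind : iIndepFun Y μ)
    (hlaw : ∀ i, μ.map (Y i) = gaussianReal (a i) (v i)) (hε0 : 0 ≤ ε) (hε1 : ε ≤ 1)
    (hN : N ≤ ∑ i, (a i ^ 2 + v i)) (hv : ∀ i, (v i : ℝ) * Fintype.card ι ≤ N) :
    μ.real {ω | ∑ i, Y i ω ^ 2 < (1 - ε) * N} ≤
      Real.exp (-(ε ^ 2 * Fintype.card ι / 16)) := by
  rcases isEmpty_or_nonempty ι with hι | hι
  · simp
  have hd : (0 : ℝ) < Fintype.card ι := by exact_mod_cast Fintype.card_pos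
  set d : ℝ := (Fintype.card ι : ℝ)
  rcases le_or_gt N 0 with h0 | h0
  · have hempty : {ω | ∑ i, Y i ω ^ 2 < (1 - ε) * N} = ∅ := by
      ext ω
      simp only [Set.mem_ofPred_eq, Set.mem_empty_iff_false, iff_false, not_lt]
      exact (mul_nonpos_of_nonneg_of_nonpos (by linarith) h0).trans
        (Finset.sum_nonneg fun i _ => sq_nonneg _)
    rw [hempty, measureReal_empty]
    exact (Real.exp_pos _).le
  set l : ℝ := ε * d / (8 * N) with hl
  have hl0 : 0 ≤ l := by positivity
  have hls : l * (N / d) = ε / 8 := by rw [hl]; field_simp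
  obtain ⟨hint, hmgf⟩ := mgf_sum_sq_le hY hind hlaw (l := -l) (s := N / d)
    (fun i => (le_div_iff₀ hd).2 (hv i)) (by rw [abs_neg, abs_of_nonneg hl0]; nlinarith)
  calc μ.real {ω | ∑ i, Y i ω ^ 2 < (1 - ε) * N}
      ≤ μ.real {ω | ∑ i, Y i ω ^ 2 ≤ (1 - ε) * N} :=
        measureReal_mono fun ω hω => by
          simp only [Set.mem_ofPred_eq] at hω ⊢
          exact hω.le
    _ ≤ _ := measure_le_le_exp_mul_mgf _ (by linarith) hint
    _ ≤ _ := mul_le_mul_of_nonneg_left hmgf (Real.exp_pos _).le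
    _ ≤ _ := by
      rw [← Real.exp_add, Real.exp_le_exp]
      have h1 : -l + 4 * (-l) ^ 2 * (N / d) = -(l * (1 - ε / 2)) := by
        rw [show 4 * (-l) ^ 2 * (N / d) = 4 * l * (l * (N / d)) by ring, hls]; ring
      rw [h1]
      have h2 := mul_le_mul_of_nonneg_left hN
        (mul_nonneg hl0 (by linarith) : 0 ≤ l * (1 - ε / 2))
      have h3 : l * N = ε * d / 8 := by rw [hl]; field_simp
      nlinarith

end NormSq

/-! ### Rows of Gaussian matrices -/

/-- The joint law of the entries is a product measure over `ι × κ`, and currying turns it into a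
product over `ι` of the row laws. -/
lemma iIndepFun_curry {ι κ : Type*} {X : ι → κ → Ω → ℝ}
    (hX : ∀ i j, Measurable (X i j)) (h : iIndepFun (fun p : ι × κ => X p.1 p.2) μ) :
    iIndepFun (fun i ω j => X i j ω) μ := by
  have := h.isProbabilityMeasure
  have : ∀ i j, IsProbabilityMeasure (μ.map (X i j)) :=
    fun i j => Measure.isProbabilityMeasure_map (hX i j).aemeasurable
  have hcurry : (MeasurableEquiv.curry ι κ ℝ) ∘ (fun ω p => X p.1 p.2 ω) =
      fun ω i j => X i j ω := rfl
  have hrow : ∀ i, iIndepFun (X i) μ := fun i =>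
    h.precomp (g := fun j => (i, j)) fun _ _ hj => congrArg Prod.snd hj
  rw [iIndepFun_iff_map_fun_eq_infinitePi_map (by fun_prop), ← hcurry,
    ← Measure.map_map (by fun_prop) (by fun_prop),
    (iIndepFun_iff_map_fun_eq_infinitePi_map (by fun_prop)).1 h,
    Measure.infinitePi_map_curry (fun i j => μ.map (X i j))]
  congrm Measure.infinitePi fun i => ?_
  rw [(iIndepFun_iff_map_fun_eq_infinitePi_map (by fun_prop)).1 (hrow i)]

lemma map_add_sum_mul_eq_gaussianReal {κ : Type*} [Fintype κ] {G : κ → Ω → ℝ}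
    (hind : iIndepFun G μ) {v : NNReal} (hG : ∀ j, Measurable (G j))
    (hlaw : ∀ j, μ.map (G j) = gaussianReal 0 v) (a : ℝ) (b : κ → ℝ) :
    μ.map (fun ω => a + ∑ j, G j ω * b j) =
      gaussianReal a (v * ∑ j, ‖b j‖₊ ^ 2) := by
  have := hind.isProbabilityMeasure
  have hterm : ∀ j, μ.map ((fun x => x * b j) ∘ G j) = gaussianReal 0 (v * ‖b j‖₊ ^ 2) :=
    fun j => by
    have h := gaussianReal_map_mul_const (μ := 0) (v := v) (b j)
    rw [← hlaw j, Measure.map_map (by fun_prop) (hG j), mul_zero, mul_comm _ v] at h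
    rw [h]
    congr 2
    ext
    simp
  have hsum : μ.map (∑ j, (fun x => x * b j) ∘ G j) = gaussianReal 0 (v * ∑ j, ‖b j‖₊ ^ 2) := by
    have := Measure.isProbabilityMeasure_map (μ := μ)
      (f := ∑ j, (fun x => x * b j) ∘ G j) (by fun_prop)
    apply Measure.ext_of_charFun
    rw [iIndepFun.charFun_map_sum_eq_prod (fun j => by fun_prop)
      (hind.comp (fun j x => x * b j) fun j => by fun_prop)]
    ext t
    simp only [Finset.prod_apply, hterm, charFun_gaussianReal, ← Complex.exp_sum]
    congr 1
    push_cast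
    simp [Finset.mul_sum, Finset.sum_mul, Finset.sum_div]
  have h := gaussianReal_map_const_add (μ := 0) (v := v * ∑ j, ‖b j‖₊ ^ 2) a
  rw [← hsum, Measure.map_map (by fun_prop) (by fun_prop), zero_add] at h
  rw [← h]
  congr 1
  ext
  simp

end StableRank

namespace StableRank

variable {Ω : Type*} [MeasurableSpace Ω] {μ : Measure Ω}

/-- `G` is a random matrix with independent `N(0, v)` entries. -/
structure IsGaussianMatrix (μ : Measure Ω) {ι κ : Type*} (G : ι → κ → Ω → ℝ) (v : NNReal) :
    Prop where
  measurable : ∀ i j, Measurable (G i j)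
  indep : iIndepFun (fun p : ι × κ => G p.1 p.2) μ
  law : ∀ i j, μ.map (G i j) = gaussianReal 0 v

namespace IsGaussianMatrix

variable {ι κ : Type*} [Fintype κ] {G : ι → κ → Ω → ℝ} {v : NNReal} {ε : ℝ}

/-- The coefficient vector may depend on the row because rows of different heads act on different
mixtures. -/
lemma indep_affine_rows (hG : IsGaussianMatrix μ G v) (a : ι → ℝ) (b : ι → κ → ℝ) :
    iIndepFun (fun i ω => a i + ∑ j, G i j ω * b i j) μ :=
  (iIndepFun_curry hG.measurable hG.indep).comp (fun i x => a i + ∑ j, x j * b i j)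
    (fun i => by fun_prop)

lemma law_affine_row (hG : IsGaussianMatrix μ G v) (a : ι → ℝ) (b : ι → κ → ℝ) (i : ι) :
    μ.map (fun ω => a i + ∑ j, G i j ω * b i j) =
      gaussianReal (a i) (v * ∑ j, ‖b i j‖₊ ^ 2) :=
  map_add_sum_mul_eq_gaussianReal
    (hG.indep.precomp (g := fun j => (i, j)) fun _ _ h => congrArg Prod.snd h)
    (hG.measurable i) (hG.law i) _ _

/-- Since `(1 + ε)(1 - ε) ≤ 1`, the upper tail can be stated with the factor `1 - ε` on the norm, so
upper and lower estimates both cost powers of the same `q`. -/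
lemma measure_upper_le [Fintype ι] [IsProbabilityMeasure μ] (hG : IsGaussianMatrix μ G v)
    (hε0 : 0 ≤ ε) (hε1 : ε ≤ 1) (a : ι → ℝ) (b : ι → κ → ℝ) {s : ℝ}
    (hs : ∀ i, v * ∑ j, b i j ^ 2 ≤ s) :
    μ.real {ω | ∑ i, a i ^ 2 + Fintype.card ι * s <
        (1 - ε) * ∑ i, (a i + ∑ j, G i j ω * b i j) ^ 2} ≤
      Real.exp (-(ε ^ 2 * Fintype.card ι / 16)) := by
  have hm := hG.measurable
  have hs' : ∀ i, ((v * ∑ j, ‖b i j‖₊ ^ 2 : NNReal) : ℝ) ≤ s := fun i => by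
    simpa using hs i
  refine le_trans (measureReal_mono ?_) (measure_lt_sum_sq_le
    (Y := fun i ω => a i + ∑ j, G i j ω * b i j) (N := ∑ i, a i ^ 2 + Fintype.card ι * s)
    (fun i => by fun_prop) (hG.indep_affine_rows a b) (hG.law_affine_row a b) hε0 hε1 ?_ ?_)
  · intro ω hω
    simp only [Set.mem_ofPred_eq] at hω ⊢
    have h0 : 0 ≤ ∑ i, (a i + ∑ j, G i j ω * b i j) ^ 2 :=
      Finset.sum_nonneg fun i _ => sq_nonneg _
    nlinarith [mul_lt_mul_of_pos_left hω (by linarith : 0 < 1 + ε),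
      mul_nonneg (sq_nonneg ε) h0]
  · rw [Finset.sum_add_distrib, Fintype.card, ← nsmul_eq_mul]
    gcongr
    exact Finset.sum_le_card_nsmul _ _ _ fun i _ => hs' i
  · intro i
    have h0 : 0 ≤ ∑ i, a i ^ 2 := Finset.sum_nonneg fun i _ => sq_nonneg _
    have := mul_le_mul_of_nonneg_right (hs' i) (Nat.cast_nonneg (α := ℝ) (Fintype.card ι))
    linarith

/-- The tail bound is applied at the full mean, where no coordinate's variance is too large, and
only then weakened to `N`. -/
lemma measure_lower_le [Fintype ι] [IsProbabilityMeasure μ] (hG : IsGaussianMatrix μ G v)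
    (hε0 : 0 ≤ ε) (hε1 : ε ≤ 1) (a : ι → ℝ) (b : κ → ℝ) {N : ℝ}
    (hN : N ≤ ∑ i, a i ^ 2 + Fintype.card ι * (v * ∑ j, b j ^ 2)) :
    μ.real {ω | ∑ i, (a i + ∑ j, G i j ω * b j) ^ 2 < (1 - ε) * N} ≤
      Real.exp (-(ε ^ 2 * Fintype.card ι / 16)) := by
  have hm := hG.measurable
  have hs' : ((v * ∑ j, ‖b j‖₊ ^ 2 : NNReal) : ℝ) = v * ∑ j, b j ^ 2 := by simp
  refine le_trans (measureReal_mono ?_) (measure_sum_sq_lt_le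
    (Y := fun i ω => a i + ∑ j, G i j ω * b j)
    (N := ∑ i, a i ^ 2 + Fintype.card ι * (v * ∑ j, b j ^ 2))
    (fun i => by fun_prop) (hG.indep_affine_rows a fun _ => b)
    (hG.law_affine_row a fun _ => b) hε0 hε1 ?_ ?_)
  · intro ω hω
    simp only [Set.mem_ofPred_eq] at hω ⊢
    exact hω.trans_le (mul_le_mul_of_nonneg_left hN (by linarith))
  · rw [hs', Finset.sum_add_distrib]
    simp
  · intro i
    have h0 : 0 ≤ ∑ i, a i ^ 2 := Finset.sum_nonneg fun i _ => sq_nonneg _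
    rw [hs']
    linarith

end IsGaussianMatrix

/-! ### Conditioning on an independent variable -/

section Indep

variable {α β γ : Type*} [MeasurableSpace α] [MeasurableSpace β] [MeasurableSpace γ]
  [IsProbabilityMeasure μ] {X : Ω → α} {Y : Ω → β} {Z : Ω → γ}

/-- Fubini for the product law: a bound uniform over frozen values of `X` survives averaging over
`X`. -/
lemma measureReal_le_of_indepFun (h : IndepFun X Y μ) (hX : Measurable X) (hY : Measurable Y)
    {S : Set (α × β)} (hS : MeasurableSet S) {δ : ℝ}
    (hδ : ∀ x, μ.real {ω | (x, Y ω) ∈ S} ≤ δ) :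
    μ.real {ω | (X ω, Y ω) ∈ S} ≤ δ := by
  have hδ0 : 0 ≤ δ := by
    obtain ⟨ω⟩ : Nonempty Ω := nonempty_of_isProbabilityMeasure μ
    exact measureReal_nonneg.trans (hδ (X ω))
  have := Measure.isProbabilityMeasure_map (μ := μ) hX.aemeasurable
  have := Measure.isProbabilityMeasure_map (μ := μ) hY.aemeasurable
  have h1 : μ {ω | (X ω, Y ω) ∈ S} = ((μ.map X).prod (μ.map Y)) S := by
    rw [← h.map_prod_eq_prod_map_map hX.aemeasurable hY.aemeasurable,
      Measure.map_apply (hX.prodMk hY) hS]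
    rfl
  have h2 : μ {ω | (X ω, Y ω) ∈ S} ≤ ENNReal.ofReal δ := by
    rw [h1, Measure.prod_apply hS]
    calc _ ≤ ∫⁻ _, ENNReal.ofReal δ ∂(μ.map X) := lintegral_mono fun x => by
          rw [Measure.map_apply hY (measurable_prodMk_left hS)]
          exact (ENNReal.le_ofReal_iff_toReal_le (measure_ne_top _ _) hδ0).2 (hδ x)
      _ = _ := by simp
  exact ENNReal.toReal_le_of_le_ofReal hδ0 h2

/-- The joint law of the triple is a product, which can be reassociated. This moves the value
weights to the side of the block input before conditioning on everything but `W_O`. -/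
lemma indepFun_prodMk_left_of_prodMk_right (h : IndepFun X (fun ω => (Y ω, Z ω)) μ)
    (hYZ : IndepFun Y Z μ) (hX : Measurable X) (hY : Measurable Y) (hZ : Measurable Z) :
    IndepFun (fun ω => (X ω, Y ω)) Z μ := by
  have := Measure.isProbabilityMeasure_map (μ := μ) hX.aemeasurable
  have := Measure.isProbabilityMeasure_map (μ := μ) hY.aemeasurable
  have := Measure.isProbabilityMeasure_map (μ := μ) hZ.aemeasurable
  have hXY : IndepFun X Y μ := h.comp measurable_id measurable_fst
  rw [indepFun_iff_map_prod_eq_prod_map_map (by fun_prop) (by fun_prop),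
    hXY.map_prod_eq_prod_map_map hX.aemeasurable hY.aemeasurable,
    ← MeasurableEquiv.prodAssoc.map_measurableEquiv_injective.eq_iff, Measure.prodAssoc_prod,
    Measure.map_map (by fun_prop) (by fun_prop)]
  have h1 := h.map_prod_eq_prod_map_map hX.aemeasurable (by fun_prop)
  rw [hYZ.map_prod_eq_prod_map_map hY.aemeasurable hZ.aemeasurable] at h1
  exact h1

end Indep

namespace IsGaussianMatrix

variable {ι κ : Type*} [Fintype ι] [Fintype κ] {G : ι → κ → Ω → ℝ} {v : NNReal} {ε : ℝ}
  [IsProbabilityMeasure μ]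

/-- Norm of `x + G b` from above, for `(x, b)` independent of `G`. -/
lemma measure_upper_le_of_indepFun (hG : IsGaussianMatrix μ G v) (hε0 : 0 ≤ ε) (hε1 : ε ≤ 1)
    {x : Ω → ι → ℝ} {b : Ω → κ → ℝ} (hx : Measurable x) (hb : Measurable b)
    (h : IndepFun (fun ω => (x ω, b ω)) (fun ω i j => G i j ω) μ) :
    μ.real {ω | ∑ i, x ω i ^ 2 + Fintype.card ι * (v * ∑ j, b ω j ^ 2) <
        (1 - ε) * ∑ i, (x ω i + ∑ j, G i j ω * b ω j) ^ 2} ≤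
      Real.exp (-(ε ^ 2 * Fintype.card ι / 16)) := by
  have hm := hG.measurable
  exact measureReal_le_of_indepFun h (by fun_prop) (by fun_prop)
    (S := {p | ∑ i, p.1.1 i ^ 2 + Fintype.card ι * (v * ∑ j, p.1.2 j ^ 2) <
        (1 - ε) * ∑ i, (p.1.1 i + ∑ j, p.2 i j * p.1.2 j) ^ 2})
    (measurableSet_lt (by fun_prop) (by fun_prop))
    (fun p => hG.measure_upper_le hε0 hε1 p.1 (fun _ => p.2) fun _ => le_rfl)

/-- Norm of `x + G b` from below, for `(x, b)` independent of `G`. -/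
lemma measure_lower_le_of_indepFun (hG : IsGaussianMatrix μ G v) (hε0 : 0 ≤ ε) (hε1 : ε ≤ 1)
    {x : Ω → ι → ℝ} {b : Ω → κ → ℝ} (hx : Measurable x) (hb : Measurable b)
    (h : IndepFun (fun ω => (x ω, b ω)) (fun ω i j => G i j ω) μ) :
    μ.real {ω | ∑ i, (x ω i + ∑ j, G i j ω * b ω j) ^ 2 < (1 - ε) * ∑ i, x ω i ^ 2} ≤
      Real.exp (-(ε ^ 2 * Fintype.card ι / 16)) := by
  have hm := hG.measurable
  exact measureReal_le_of_indepFun h (by fun_prop) (by fun_prop)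
    (S := {p | ∑ i, (p.1.1 i + ∑ j, p.2 i j * p.1.2 j) ^ 2 < (1 - ε) * ∑ i, p.1.1 i ^ 2})
    (measurableSet_lt (by fun_prop) (by fun_prop))
    (fun p => hG.measure_lower_le hε0 hε1 p.1 p.2 (le_add_of_nonneg_right (by positivity)))

/-- Norm from above of a vector of products of the rows of `G` with independent vectors. -/
lemma measure_rows_upper_le_of_indepFun (hG : IsGaussianMatrix μ G v) (hε0 : 0 ≤ ε) (hε1 : ε ≤ 1)
    {b : Ω → ι → κ → ℝ} (hb : Measurable b) (hb1 : ∀ ω i, v * ∑ j, b ω i j ^ 2 ≤ 1)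
    (h : IndepFun b (fun ω i j => G i j ω) μ) :
    μ.real {ω | (Fintype.card ι : ℝ) < (1 - ε) * ∑ i, (∑ j, G i j ω * b ω i j) ^ 2} ≤
      Real.exp (-(ε ^ 2 * Fintype.card ι / 16)) := by
  have hm := hG.measurable
  refine le_trans (measureReal_mono ?_) (measureReal_le_of_indepFun h hb (by fun_prop)
    -- The norm constraint is built into `S`: for frozen vectors violating it the slice is empty, so
    -- a bound uniform over all frozen values still holds.
    (S := {p | ∀ i, v * ∑ j, p.1 i j ^ 2 ≤ 1} ∩
      {p | (Fintype.card ι : ℝ) < (1 - ε) * ∑ i, (∑ j, p.2 i j * p.1 i j) ^ 2}) ?_ fun p => ?_)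
  · intro ω hω
    exact ⟨hb1 ω, hω⟩
  · refine MeasurableSet.inter ?_ (measurableSet_lt (by fun_prop) (by fun_prop))
    rw [Set.ofPred_forall]
    exact MeasurableSet.iInter fun i => measurableSet_le (by fun_prop) (by fun_prop)
  · by_cases hp : ∀ i, v * ∑ j, p i j ^ 2 ≤ 1
    · refine le_trans (measureReal_mono ?_) (hG.measure_upper_le hε0 hε1 0 p hp)
      rintro ω ⟨-, hω⟩
      simpa using hω
    · refine le_trans (le_of_eq ?_) (Real.exp_pos _).le
      convert measureReal_empty
      ext ω
      simp only [Set.mem_ofPred_eq, Set.mem_empty_iff_false, iff_false]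
      exact fun h => hp h.1

end IsGaussianMatrix

end StableRank

namespace StableRank

/-! ### Deterministic bounds on the stable rank -/

section Deterministic

variable {d n : ℕ}

lemma sum_mulVec_sq_le (A : Matrix (Fin d) (Fin n) ℝ) (u : Fin n → ℝ) :
    ∑ i, (A.mulVec u) i ^ 2 ≤ opNorm A ^ 2 * ∑ t, u t ^ 2 := by
  have h := (Matrix.toEuclideanLin A).toContinuousLinearMap.le_opNorm (WithLp.toLp 2 u)
  have h2 := pow_le_pow_left₀ (norm_nonneg _) h 2
  rw [mul_pow, EuclideanSpace.norm_sq_eq, EuclideanSpace.norm_sq_eq] at h2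
  simpa [opNorm] using h2

lemma frobSq_eq_sum_colNormSq (A : Matrix (Fin d) (Fin n) ℝ) :
    frobSq A = ∑ t, colNormSq A t :=
  Finset.sum_comm

lemma frobSq_nonneg (A : Matrix (Fin d) (Fin n) ℝ) : 0 ≤ frobSq A :=
  Finset.sum_nonneg fun _ _ => Finset.sum_nonneg fun _ _ => sq_nonneg _

lemma colNormSq_nonneg (A : Matrix (Fin d) (Fin n) ℝ) (t : Fin n) : 0 ≤ colNormSq A t :=
  Finset.sum_nonneg fun _ _ => sq_nonneg _

/-- Only an inequality, because a zero column is normalized to zero by the convention `0 / 0 = 0`.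
-/
lemma colNormSq_rmsNorm_le (X : Matrix (Fin d) (Fin n) ℝ) (t : Fin n) :
    colNormSq (rmsNorm X) t ≤ d := by
  have h0 := colNormSq_nonneg X t
  have h : colNormSq (rmsNorm X) t = d * (colNormSq X t / colNormSq X t) := by
    unfold colNormSq at h0
    simp only [colNormSq, rmsNorm, mul_pow, div_pow]
    rw [Real.sq_sqrt (Nat.cast_nonneg d), Real.sq_sqrt h0, ← Finset.mul_sum, ← Finset.sum_div]
  rw [h]
  exact mul_le_of_le_one_right (Nat.cast_nonneg d) (div_self_le_one _)

lemma frobSq_rmsNorm_le (X : Matrix (Fin d) (Fin n) ℝ) : frobSq (rmsNorm X) ≤ d * n := by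
  rw [frobSq_eq_sum_colNormSq]
  calc _ ≤ ∑ _t : Fin n, (d : ℝ) := Finset.sum_le_sum fun t _ => colNormSq_rmsNorm_le X t
    _ = _ := by simp [mul_comm]

/-- A test vector bounds the stable rank from above. -/
lemma stableRank_le_of_mulVec {A : Matrix (Fin d) (Fin n) ℝ} {u : Fin n → ℝ} {F Q : ℝ}
    (hF : frobSq A ≤ F) (hQ : 0 < Q) (h : Q ≤ opNorm A ^ 2 * ∑ t, u t ^ 2) :
    stableRank A ≤ F * (∑ t, u t ^ 2) / Q := by
  have hu : 0 ≤ ∑ t, u t ^ 2 := Finset.sum_nonneg fun _ _ => sq_nonneg _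
  have hop : 0 < opNorm A ^ 2 := by
    by_contra hcon
    have : opNorm A ^ 2 = 0 := le_antisymm (not_lt.1 hcon) (sq_nonneg _)
    rw [this] at h
    linarith
  rw [stableRank, div_le_div_iff₀ hop hQ]
  calc frobSq A * Q ≤ F * (opNorm A ^ 2 * ∑ t, u t ^ 2) :=
        mul_le_mul hF h hQ.le ((frobSq_nonneg A).trans hF)
    _ = _ := by ring

/-- RMS normalization can shrink the image of a test vector only by the largest column norm. -/
lemma mulVec_sq_le_opNorm_rmsNorm (hd : 0 < d) (X : Matrix (Fin d) (Fin n) ℝ) (u : Fin n → ℝ)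
    {R : ℝ} (hR : ∀ t, colNormSq X t ≤ R) :
    d * ∑ i, (X.mulVec u) i ^ 2 ≤ opNorm (rmsNorm X) ^ 2 * (R * ∑ t, u t ^ 2) := by
  have hd' : (0 : ℝ) < d := by exact_mod_cast hd
  -- The normalization is undone inside the test vector: weighting `u` by the column norms gives a
  -- vector which `rmsNorm X` maps to `√d · X u`.
  have hX : ∀ i, √(d : ℝ) * (X.mulVec u) i =
      ((rmsNorm X).mulVec fun t => √(colNormSq X t) * u t) i := fun i => by
    simp only [Matrix.mulVec, dotProduct, Finset.mul_sum, rmsNorm]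
    refine Finset.sum_congr rfl fun t _ => ?_
    by_cases h0 : colNormSq X t = 0
    · have : X i t = 0 := by
        have := (Finset.sum_eq_zero_iff_of_nonneg fun i _ => sq_nonneg (X i t)).1 h0 i
          (Finset.mem_univ i)
        simpa using this
      simp [this]
    · have : √(colNormSq X t) ≠ 0 :=
        (Real.sqrt_pos.2 ((colNormSq_nonneg X t).lt_of_ne' h0)).ne'
      field_simp
  calc d * ∑ i, (X.mulVec u) i ^ 2 = ∑ i, (√(d : ℝ) * (X.mulVec u) i) ^ 2 := by
        simp_rw [mul_pow, Real.sq_sqrt hd'.le, Finset.mul_sum]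
    _ ≤ opNorm (rmsNorm X) ^ 2 * ∑ t, (√(colNormSq X t) * u t) ^ 2 := by
        simp_rw [hX]
        exact sum_mulVec_sq_le _ _
    _ ≤ _ := by
        gcongr
        rw [Finset.mul_sum]
        refine Finset.sum_le_sum fun t _ => ?_
        rw [mul_pow, Real.sq_sqrt (colNormSq_nonneg X t)]
        exact mul_le_mul_of_nonneg_right (hR t) (sq_nonneg _)

/-- The Frobenius norm of a normalized matrix is at most `d n` whatever `X` is, so only the operator
norm needs a lower bound, and the reweighted test vector supplies it. -/
lemma stableRank_rmsNorm_le (hd : 0 < d) {X : Matrix (Fin d) (Fin n) ℝ} {u : Fin n → ℝ}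
    {R Q : ℝ} (hR : ∀ t, colNormSq X t ≤ R) (hQ : 0 < Q) (hXu : Q ≤ ∑ i, (X.mulVec u) i ^ 2) :
    stableRank (rmsNorm X) ≤ n * R * (∑ t, u t ^ 2) / Q := by
  have hd' : (0 : ℝ) < d := by exact_mod_cast hd
  have h := mulVec_sq_le_opNorm_rmsNorm hd X u hR
  have hdQ : d * Q ≤ opNorm (rmsNorm X) ^ 2 * (R * ∑ t, u t ^ 2) :=
    (mul_le_mul_of_nonneg_left hXu hd'.le).trans h
  have hop : 0 < opNorm (rmsNorm X) ^ 2 := by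
    by_contra hcon
    have h0 : opNorm (rmsNorm X) ^ 2 = 0 := le_antisymm (not_lt.1 hcon) (sq_nonneg _)
    rw [h0, zero_mul] at hdQ
    nlinarith [mul_pos hd' hQ]
  rw [stableRank, div_le_div_iff₀ hop hQ]
  calc frobSq (rmsNorm X) * Q ≤ d * n * Q := by gcongr; exact frobSq_rmsNorm_le X
    _ = n * (d * Q) := by ring
    _ ≤ n * (opNorm (rmsNorm X) ^ 2 * (R * ∑ t, u t ^ 2)) := by gcongr
    _ = _ := by ring

/-- Column norms of a convex mixture of normalized columns. -/
lemma sum_sq_rmsNorm_mul_le (X : Matrix (Fin d) (Fin n) ℝ) (P : Matrix (Fin n) (Fin n) ℝ)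
    (t : Fin n) (hP : (fun i => P i t) ∈ stdSimplex ℝ (Fin n)) :
    ∑ j, (rmsNorm X * P) j t ^ 2 ≤ d := by
  obtain ⟨h0, h1⟩ := hP
  calc ∑ j, (rmsNorm X * P) j t ^ 2 ≤ ∑ j, ∑ s, P s t * rmsNorm X j s ^ 2 := by
        refine Finset.sum_le_sum fun j _ => ?_
        have := (even_two.convexOn_pow (𝕜 := ℝ)).map_sum_le (t := Finset.univ)
          (w := fun s => P s t) (p := fun s => rmsNorm X j s) (fun s _ => h0 s) h1
          (fun _ _ => Set.mem_univ _)
        simpa [Matrix.mul_apply, mul_comm] using this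
    _ = ∑ s, P s t * colNormSq (rmsNorm X) s := by
        rw [Finset.sum_comm]
        simp [colNormSq, Finset.mul_sum]
    _ ≤ ∑ s, P s t * d :=
        Finset.sum_le_sum fun s _ => mul_le_mul_of_nonneg_left (colNormSq_rmsNorm_le X s) (h0 s)
    _ = d := by rw [← Finset.sum_mul, h1, one_mul]

lemma exists_card_eq_mul_pMax {V : ℕ} (hn : 0 < n) (tok : Fin n → Fin V) :
    ∃ j, ((Finset.univ.filter fun t => tok t = j).card : ℝ) = n * pMax tok := by
  have hn' : (0 : ℝ) < n := by exact_mod_cast hn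
  have : Nonempty (Fin V) := ⟨tok ⟨0, hn⟩⟩
  obtain ⟨j, hj⟩ := exists_eq_ciSup_of_finite
    (f := fun j : Fin V => ((Finset.univ.filter fun t => tok t = j).card : ℝ) / n)
  refine ⟨j, ?_⟩
  rw [pMax, ← hj]
  field_simp

lemma pMax_pos {V : ℕ} (hn : 0 < n) (tok : Fin n → Fin V) : 0 < pMax tok := by
  have hn' : (0 : ℝ) < n := by exact_mod_cast hn
  refine lt_of_lt_of_le ?_ (le_ciSup (Finite.bddAbove_range
    fun j : Fin V => ((Finset.univ.filter fun t => tok t = j).card : ℝ) / n) (tok ⟨0, hn⟩))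
  have : 0 < (Finset.univ.filter fun t => tok t = tok ⟨0, hn⟩).card :=
    Finset.card_pos.2 ⟨⟨0, hn⟩, by simp⟩
  positivity

end Deterministic

/-! ### Measurability -/

section Measurability

variable {Ω : Type*} [MeasurableSpace Ω] {d n k : ℕ}

lemma measurable_colNormSq {A : Ω → Matrix (Fin d) (Fin n) ℝ}
    (hA : ∀ i t, Measurable fun ω => A ω i t) (t : Fin n) :
    Measurable fun ω => colNormSq (A ω) t := by
  unfold colNormSq
  fun_prop

/-- The operator norm is a norm composed with a linear map on a finite-dimensional space, hence
continuous in the entries. -/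
lemma measurable_opNorm {A : Ω → Matrix (Fin d) (Fin n) ℝ}
    (hA : ∀ i t, Measurable fun ω => A ω i t) : Measurable fun ω => opNorm (A ω) := by
  let f : (Fin d → Fin n → ℝ) →ₗ[ℝ] (EuclideanSpace ℝ (Fin n) →L[ℝ] EuclideanSpace ℝ (Fin d)) :=
    (LinearMap.toContinuousLinearMap.toLinearMap ∘ₗ
      (Matrix.toEuclideanLin (𝕜 := ℝ) (m := Fin d) (n := Fin n)).toLinearMap) ∘ₗ
      (Matrix.ofLinearEquiv ℝ).toLinearMap
  have hf : Continuous fun B : Fin d → Fin n → ℝ => ‖f B‖ :=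
    (LinearMap.continuous_of_finiteDimensional f).norm
  exact hf.measurable.comp (measurable_pi_iff.2 fun i => measurable_pi_iff.2 fun t => hA i t)

lemma measurable_stableRank {A : Ω → Matrix (Fin d) (Fin n) ℝ}
    (hA : ∀ i t, Measurable fun ω => A ω i t) : Measurable fun ω => stableRank (A ω) := by
  have := measurable_opNorm hA
  unfold stableRank frobSq
  fun_prop

lemma measurable_rmsNorm {A : Ω → Matrix (Fin d) (Fin n) ℝ}
    (hA : ∀ i t, Measurable fun ω => A ω i t) (i : Fin d) (t : Fin n) :
    Measurable fun ω => rmsNorm (A ω) i t := by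
  have := measurable_colNormSq hA t
  unfold rmsNorm
  fun_prop

lemma measurable_matrix_mul {A : Ω → Matrix (Fin d) (Fin k) ℝ} {B : Ω → Matrix (Fin k) (Fin n) ℝ}
    (hA : ∀ i t, Measurable fun ω => A ω i t) (hB : ∀ i t, Measurable fun ω => B ω i t)
    (i : Fin d) (t : Fin n) : Measurable fun ω => (A ω * B ω) i t := by
  simp only [Matrix.mul_apply]
  fun_prop

end Measurability

end StableRank

/-! ### Independence of disjoint blocks of weights, and union bounds -/

namespace StableRank

lemma indepFun_tuple_of_iIndepFun {Ω ι α β : Type*} [MeasurableSpace Ω] {μ : Measure Ω}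
    [Fintype α] [Fintype β] {f : ι → Ω → ℝ} (hf : iIndepFun f μ) (hm : ∀ i, Measurable (f i))
    (g₁ : α → ι) (g₂ : β → ι) (hg : ∀ a b, g₁ a ≠ g₂ b) :
    IndepFun (fun ω a => f (g₁ a) ω) (fun ω b => f (g₂ b) ω) μ := by
  classical
  have h := hf.indepFun_finset (Finset.univ.image g₁) (Finset.univ.image g₂)
    (by
      rw [Finset.disjoint_left]
      simp only [Finset.mem_image, Finset.mem_univ, true_and]
      rintro _ ⟨a, rfl⟩ ⟨b, hb⟩
      exact hg a b hb.symm) hm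
  exact h.comp (φ := fun x a => x ⟨g₁ a, Finset.mem_image_of_mem _ (Finset.mem_univ a)⟩)
    (ψ := fun x b => x ⟨g₂ b, Finset.mem_image_of_mem _ (Finset.mem_univ b)⟩)
    (by fun_prop) (by fun_prop)

section UnionBound

variable {Ω : Type*} [MeasurableSpace Ω] {μ : Measure Ω} [IsFiniteMeasure μ]

/-- Failure sets are only ever bounded above, so subadditivity suffices and the events need not be
measurable. -/
lemma measureReal_not_and_le (p q : Ω → Prop) :
    μ.real {ω | ¬ (p ω ∧ q ω)} ≤ μ.real {ω | ¬ p ω} + μ.real {ω | ¬ q ω} := by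
  refine le_trans (measureReal_mono fun ω hω => ?_) (measureReal_union_le _ _)
  simp only [Set.mem_ofPred_eq, Set.mem_union] at hω ⊢
  tauto

lemma measureReal_not_forall_le {n : ℕ} {p : Fin n → Ω → Prop} {δ : ℝ}
    (h : ∀ t, μ.real {ω | ¬ p t ω} ≤ δ) : μ.real {ω | ¬ ∀ t, p t ω} ≤ n * δ := by
  calc μ.real {ω | ¬ ∀ t, p t ω} ≤ μ.real (⋃ t, {ω | ¬ p t ω}) :=
        measureReal_mono fun ω hω => by
          simpa [Set.mem_ofPred_eq, Set.mem_iUnion] using hω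
    _ ≤ ∑ t, μ.real {ω | ¬ p t ω} := measureReal_iUnion_fintype_le _
    _ ≤ ∑ _t : Fin n, δ := Finset.sum_le_sum fun t _ => h t
    _ = n * δ := by simp

end UnionBound

/-- The head and the row inside that head of a row of the stacked matrix. -/
def headRow {d nHead : ℕ} (hdvd : nHead ∣ d) : Fin d ≃ Fin nHead × Fin (d / nHead) :=
  (finCongr (Nat.mul_div_cancel' hdvd).symm).trans finProdFinEquiv.symm

/-! ### Typical events of the sublayers -/

namespace Transformer

variable {Ω : Type*} {V d nHead k n : ℕ} (T : Transformer Ω V d nHead k n)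

/-- The concatenated head outputs `H⁽ˡ⁾`. -/
noncomputable def headOut (ℓ : ℕ) (ω : Ω) : Matrix (Fin d) (Fin n) ℝ :=
  concatHeads T.head_dvd fun h => T.WV ℓ h ω * (rmsNorm (T.hidden ℓ ω) * T.P ℓ h ω)

lemma headOut_apply (ℓ : ℕ) (ω : Ω) (i : Fin d) (t : Fin n) :
    T.headOut ℓ ω i t = ∑ j, T.WV ℓ (headRow T.head_dvd i).1 ω (headRow T.head_dvd i).2 j *
      (rmsNorm (T.hidden ℓ ω) * T.P ℓ (headRow T.head_dvd i).1 ω) j t :=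
  rfl

lemma hiddenAtt_eq (ℓ : ℕ) (ω : Ω) :
    T.hiddenAtt ℓ ω = T.hidden ℓ ω + T.WO ℓ ω * T.headOut ℓ ω :=
  rfl

lemma hidden_succ (ℓ : ℕ) (ω : Ω) :
    T.hidden (ℓ + 1) ω = T.hiddenAtt ℓ ω + T.W2 ℓ ω * T.B ℓ ω :=
  rfl

/-- The attention sublayer has the typical effect on all column norms and on the test vector. -/
def AttentionTypical (q : ℝ) (u : Fin n → ℝ) (ℓ : ℕ) (ω : Ω) : Prop :=
  (∀ t, q * colNormSq (T.headOut ℓ ω) t ≤ d) ∧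
  (∀ t, q * colNormSq (T.hiddenAtt ℓ ω) t ≤
    colNormSq (T.hidden ℓ ω) t + colNormSq (T.headOut ℓ ω) t) ∧
  q * ∑ i, ((T.hidden ℓ ω).mulVec u) i ^ 2 ≤ ∑ i, ((T.hiddenAtt ℓ ω).mulVec u) i ^ 2

/-- The MLP sublayer has the typical effect on all column norms and on the test vector. -/
def MlpTypical (q : ℝ) (u : Fin n → ℝ) (ℓ : ℕ) (ω : Ω) : Prop :=
  (∀ t, q * colNormSq (T.hidden (ℓ + 1) ω) t ≤
    colNormSq (T.hiddenAtt ℓ ω) t + d * ((k : ℝ)⁻¹ * colNormSq (T.B ℓ ω) t)) ∧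
  q * ∑ i, ((T.hiddenAtt ℓ ω).mulVec u) i ^ 2 ≤ ∑ i, ((T.hidden (ℓ + 1) ω).mulVec u) i ^ 2

/-- The embedding has the typical column norms, `j` being the reference token. -/
def EmbeddingTypical (q : ℝ) (j : Fin V) (ω : Ω) : Prop :=
  (∀ t, q * colNormSq (T.hidden 0 ω) t ≤ d) ∧ q * d ≤ colNormSq (T.E ω) j

/-! ### Gaussian weight matrices, measurability and independence within a layer -/

namespace GaussianInit

variable {T} [MeasurableSpace Ω] {μ : Measure Ω} {L ℓ : ℕ}

lemma isGaussianMatrix_E (hT : T.GaussianInit μ L) :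
    IsGaussianMatrix μ (fun i j ω => T.E ω i j) 1 where
  measurable i j := hT.measurable_weight (.embed i j)
  indep := by
    have hg : Function.Injective
        fun p : Fin d × Fin V => (.embed p.1 p.2 : WeightIdx L V d nHead k) := fun p p' h => by
      simpa [Prod.ext_iff] using h
    exact hT.indep.precomp hg
  law i j := hT.law (.embed i j)

lemma isGaussianMatrix_WO (hT : T.GaussianInit μ L) (hℓ : ℓ < L) :
    IsGaussianMatrix μ (fun i j ω => T.WO ℓ ω i j) (d : NNReal)⁻¹ where
  measurable i j := hT.measurable_weight (.out ⟨ℓ, hℓ⟩ i j)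
  indep := by
    have hg : Function.Injective
        fun p : Fin d × Fin d => (.out ⟨ℓ, hℓ⟩ p.1 p.2 : WeightIdx L V d nHead k) := fun p p' h => by
      simpa [Prod.ext_iff] using h
    exact hT.indep.precomp hg
  law i j := hT.law (.out ⟨ℓ, hℓ⟩ i j)

lemma isGaussianMatrix_W2 (hT : T.GaussianInit μ L) (hℓ : ℓ < L) :
    IsGaussianMatrix μ (fun i j ω => T.W2 ℓ ω i j) (k : NNReal)⁻¹ where
  measurable i j := hT.measurable_weight (.mlp ⟨ℓ, hℓ⟩ i j)
  indep := by
    have hg : Function.Injective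
        fun p : Fin d × Fin k => (.mlp ⟨ℓ, hℓ⟩ p.1 p.2 : WeightIdx L V d nHead k) := fun p p' h => by
      simpa [Prod.ext_iff] using h
    exact hT.indep.precomp hg
  law i j := hT.law (.mlp ⟨ℓ, hℓ⟩ i j)

/-- The value projections of all heads stack to a single `d × d` Gaussian matrix, so the
concentration is in dimension `d`, not `d / nHead`. -/
lemma isGaussianMatrix_WV (hT : T.GaussianInit μ L) (hℓ : ℓ < L) : IsGaussianMatrix μ
    (fun i j ω => T.WV ℓ (headRow T.head_dvd i).1 ω (headRow T.head_dvd i).2 j)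
    (d : NNReal)⁻¹ where
  measurable i j :=
    hT.measurable_weight (.value ⟨ℓ, hℓ⟩ (headRow T.head_dvd i).1 (headRow T.head_dvd i).2 j)
  indep := by
    have hg : Function.Injective fun p : Fin d × Fin d => (.value ⟨ℓ, hℓ⟩
        (headRow T.head_dvd p.1).1 (headRow T.head_dvd p.1).2 p.2 : WeightIdx L V d nHead k) :=
      fun p p' h => by
        simp only [WeightIdx.value.injEq, true_and] at h
        exact Prod.ext ((headRow T.head_dvd).injective (Prod.ext h.1 h.2.1)) h.2.2
    exact hT.indep.precomp hg
  law i j := hT.law (.value ⟨ℓ, hℓ⟩ (headRow T.head_dvd i).1 (headRow T.head_dvd i).2 j)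

lemma measurable_WV (hT : T.GaussianInit μ L) (hℓ : ℓ < L) (h : Fin nHead)
    (i : Fin (d / nHead)) (j : Fin d) : Measurable fun ω => T.WV ℓ h ω i j :=
  hT.measurable_weight (.value ⟨ℓ, hℓ⟩ h i j)

lemma measurable_headOut (hT : T.GaussianInit μ L) (hℓ : ℓ < L) (hX : ∀ i t, Measurable fun ω => T.hidden ℓ ω i t)
    (i : Fin d) (t : Fin n) : Measurable fun ω => T.headOut ℓ ω i t := by
  simp only [headOut_apply]
  refine Finset.measurable_sum _ fun j _ => (hT.measurable_WV hℓ _ _ _).mul ?_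
  exact measurable_matrix_mul (measurable_rmsNorm hX) (hT.measurable_P ℓ hℓ _) j t

lemma measurable_hiddenAtt_of_hidden (hT : T.GaussianInit μ L) (hℓ : ℓ < L)
    (hX : ∀ i t, Measurable fun ω => T.hidden ℓ ω i t) (i : Fin d) (t : Fin n) :
    Measurable fun ω => T.hiddenAtt ℓ ω i t :=
  (hX i t).add (measurable_matrix_mul (hT.isGaussianMatrix_WO hℓ).measurable
    (hT.measurable_headOut hℓ hX) i t)

lemma measurable_hidden (hT : T.GaussianInit μ L) (hℓ : ℓ ≤ L) (i : Fin d) (t : Fin n) :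
    Measurable fun ω => T.hidden ℓ ω i t := by
  induction ℓ generalizing i t with
  | zero => exact hT.measurable_weight (.embed i (T.tok t))
  | succ ℓ ih =>
    exact (hT.measurable_hiddenAtt_of_hidden hℓ (ih (Nat.le_of_succ_le hℓ)) i t).add
      (measurable_matrix_mul (hT.isGaussianMatrix_W2 hℓ).measurable (hT.measurable_B ℓ hℓ) i t)

lemma measurable_hiddenAtt (hT : T.GaussianInit μ L) (hℓ : ℓ < L) (i : Fin d) (t : Fin n) :
    Measurable fun ω => T.hiddenAtt ℓ ω i t :=
  hT.measurable_hiddenAtt_of_hidden hℓ (hT.measurable_hidden hℓ.le) i t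

lemma indepFun_WV_WO (hT : T.GaussianInit μ L) (hℓ : ℓ < L) :
    IndepFun (fun ω h i j => T.WV ℓ h ω i j) (fun ω i j => T.WO ℓ ω i j) μ := by
  have h := indepFun_tuple_of_iIndepFun hT.indep hT.measurable_weight
    (fun p : Fin nHead × Fin (d / nHead) × Fin d => .value ⟨ℓ, hℓ⟩ p.1 p.2.1 p.2.2)
    (fun p : Fin d × Fin d => .out ⟨ℓ, hℓ⟩ p.1 p.2) (fun _ _ h => by cases h)
  exact h.comp (φ := fun x h i j => x (h, i, j)) (ψ := fun x i j => x (i, j))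
    (by fun_prop) (by fun_prop)

lemma indepFun_mixed_WV (hT : T.GaussianInit μ L) (hℓ : ℓ < L) (t : Fin n) :
    IndepFun (fun ω i j =>
        (rmsNorm (T.hidden ℓ ω) * T.P ℓ (headRow T.head_dvd i).1 ω) j t)
      (fun ω i j => T.WV ℓ (headRow T.head_dvd i).1 ω (headRow T.head_dvd i).2 j) μ := by
  refine (hT.indep_P ℓ hℓ).comp
    (φ := fun p i j =>
      (rmsNorm (Matrix.of p.1) * Matrix.of (p.2 (headRow T.head_dvd i).1)) j t)
    (ψ := fun p i j => p.1 (headRow T.head_dvd i).1 (headRow T.head_dvd i).2 j)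
    (measurable_pi_iff.2 fun i => measurable_pi_iff.2 fun j => ?_) (by fun_prop)
  exact measurable_matrix_mul (measurable_rmsNorm fun i t => by
    simp only [Matrix.of_apply]; fun_prop) (fun i t => by
    simp only [Matrix.of_apply]; fun_prop) j t

/-! ### Failure probabilities of the typical events -/

variable [IsProbabilityMeasure μ] {ε : ℝ}

/-- A column of `E` is `E` applied to a basis vector, so the general row estimates apply with zero
offset. -/
lemma measure_not_embeddingTypical_le (hT : T.GaussianInit μ L) (hε0 : 0 ≤ ε) (hε1 : ε ≤ 1)
    (j : Fin V) :
    μ.real {ω | ¬ T.EmbeddingTypical (1 - ε) j ω} ≤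
      (n + 1) * Real.exp (-(ε ^ 2 * d / 16)) := by
  classical
  have hE := hT.isGaussianMatrix_E
  rw [add_mul, one_mul]
  refine (measureReal_not_and_le _ _).trans
    (add_le_add (measureReal_not_forall_le fun t => ?_) ?_)
  · have h := hE.measure_upper_le hε0 hε1 0 (fun _ => Pi.single (T.tok t) 1) (s := 1)
      (fun _ => by simp [Pi.single_apply])
    simpa [Pi.single_apply, colNormSq, hidden, embedded] using h
  · have h := hE.measure_lower_le hε0 hε1 0 (Pi.single j 1) (N := d)
      (by simp [Pi.single_apply])
    simpa [Pi.single_apply, colNormSq] using h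

/-- Columns and test vector are handled alike, since `(X + W₂ B) u = X u + W₂ (B u)`: `n` upper
tails and one lower tail. -/
lemma measure_not_mlpTypical_le (hT : T.GaussianInit μ L) (hε0 : 0 ≤ ε) (hε1 : ε ≤ 1)
    (hℓ : ℓ < L) (u : Fin n → ℝ) :
    μ.real {ω | ¬ T.MlpTypical (1 - ε) u ℓ ω} ≤ (n + 1) * Real.exp (-(ε ^ 2 * d / 16)) := by
  have hW := hT.isGaussianMatrix_W2 hℓ
  have hX := hT.measurable_hiddenAtt hℓ
  have hB := hT.measurable_B ℓ hℓ
  rw [add_mul, one_mul]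
  refine (measureReal_not_and_le _ _).trans
    (add_le_add (measureReal_not_forall_le fun t => ?_) ?_)
  · have h := hW.measure_upper_le_of_indepFun hε0 hε1
      (x := fun ω i => T.hiddenAtt ℓ ω i t) (b := fun ω i => T.B ℓ ω i t)
      (by fun_prop) (by fun_prop)
      ((hT.indep_B ℓ hℓ).comp (φ := fun p => (fun i => p.1 i t, fun i => p.2 i t))
        (by fun_prop) measurable_id)
    simpa [colNormSq, hidden_succ, Matrix.mul_apply] using h
  · have h := hW.measure_lower_le_of_indepFun hε0 hε1
      (x := fun ω i => ∑ t, T.hiddenAtt ℓ ω i t * u t) (b := fun ω i => ∑ t, T.B ℓ ω i t * u t)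
      (by fun_prop) (by fun_prop)
      ((hT.indep_B ℓ hℓ).comp
        (φ := fun p => (fun i => ∑ t, p.1 i t * u t, fun i => ∑ t, p.2 i t * u t))
        (by fun_prop) measurable_id)
    simp only [hidden_succ, Matrix.add_mulVec, ← Matrix.mulVec_mulVec, not_le]
    rw [Fintype.card_fin] at h
    exact h

/-- The input and the mixed heads of the attention sublayer are independent of `W_O`. -/
lemma indepFun_hidden_headOut_WO (hT : T.GaussianInit μ L) (hℓ : ℓ < L) :
    IndepFun (fun ω => ((fun i t => T.hidden ℓ ω i t, fun i t => T.headOut ℓ ω i t) :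
        (Fin d → Fin n → ℝ) × (Fin d → Fin n → ℝ)))
      (fun ω i j => T.WO ℓ ω i j) μ := by
  have hX := hT.measurable_hidden hℓ.le
  have hP := hT.measurable_P ℓ hℓ
  have hV := hT.measurable_WV hℓ
  have hO := (hT.isGaussianMatrix_WO hℓ).measurable
  have h1 := (hT.indep_P ℓ hℓ).comp (φ := id) (ψ := fun p => (p.1, p.2.1)) measurable_id
    (by fun_prop)
  have h2 := indepFun_prodMk_left_of_prodMk_right h1 (hT.indepFun_WV_WO hℓ) (by fun_prop)
    (by fun_prop) (by fun_prop)
  refine h2.comp (φ := fun p : ((Fin d → Fin n → ℝ) × (Fin nHead → Fin n → Fin n → ℝ)) ×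
      (Fin nHead → Fin (d / nHead) → Fin d → ℝ) => (p.1.1, fun i t =>
        ∑ j, p.2 (headRow T.head_dvd i).1 (headRow T.head_dvd i).2 j *
          (rmsNorm (Matrix.of p.1.1) * Matrix.of (p.1.2 (headRow T.head_dvd i).1)) j t))
    (Measurable.prodMk (by fun_prop) (measurable_pi_iff.2 fun i => measurable_pi_iff.2 fun t => ?_))
    measurable_id
  refine Finset.measurable_sum _ fun j _ => Measurable.mul (by fun_prop) ?_
  exact measurable_matrix_mul (measurable_rmsNorm fun i t => by
    simp only [Matrix.of_apply]; fun_prop) (fun i t => by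
    simp only [Matrix.of_apply]; fun_prop) j t

/-- Two stages of randomness: `n` upper tails over `W_V` for the head outputs, then `n` upper tails
and one lower tail over `W_O` with the head outputs frozen. -/
lemma measure_not_attentionTypical_le (hT : T.GaussianInit μ L) (hε0 : 0 ≤ ε) (hε1 : ε ≤ 1)
    (hd : 0 < d) (hℓ : ℓ < L) (u : Fin n → ℝ) :
    μ.real {ω | ¬ T.AttentionTypical (1 - ε) u ℓ ω} ≤
      (2 * n + 1) * Real.exp (-(ε ^ 2 * d / 16)) := by
  have hd' : (d : ℝ) ≠ 0 := by exact_mod_cast hd.ne'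
  have hW := hT.isGaussianMatrix_WO hℓ
  have hX := hT.measurable_hidden hℓ.le
  have hP := hT.measurable_P ℓ hℓ
  have hH := hT.measurable_headOut hℓ hX
  have hind := hT.indepFun_hidden_headOut_WO hℓ
  rw [show (2 * n + 1 : ℝ) = n + (n + 1) by ring, add_mul, add_mul _ 1, one_mul]
  refine (measureReal_not_and_le _ _).trans (add_le_add (measureReal_not_forall_le fun t => ?_)
    ((measureReal_not_and_le _ _).trans
      (add_le_add (measureReal_not_forall_le fun t => ?_) ?_)))
  · have h := (hT.isGaussianMatrix_WV hℓ).measure_rows_upper_le_of_indepFun hε0 hε1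
      (b := fun ω i j => (rmsNorm (T.hidden ℓ ω) * T.P ℓ (headRow T.head_dvd i).1 ω) j t)
      (by
        refine measurable_pi_iff.2 fun i => measurable_pi_iff.2 fun j => ?_
        exact measurable_matrix_mul (measurable_rmsNorm hX) (hP _) j t)
      (fun ω i => by
        have := sum_sq_rmsNorm_mul_le (T.hidden ℓ ω) (T.P ℓ (headRow T.head_dvd i).1 ω) t
          (hT.stochastic ℓ hℓ _ ω t)
        rw [NNReal.coe_inv, NNReal.coe_natCast, inv_mul_le_iff₀ (by positivity), mul_one]
        exact this)
      (hT.indepFun_mixed_WV hℓ t)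
    simpa [colNormSq, headOut_apply] using h
  · have h := hW.measure_upper_le_of_indepFun hε0 hε1
      (x := fun ω i => T.hidden ℓ ω i t) (b := fun ω i => T.headOut ℓ ω i t)
      (by fun_prop) (by fun_prop)
      (hind.comp (φ := fun p => (fun i => p.1 i t, fun i => p.2 i t))
        (by fun_prop) measurable_id)
    simpa [colNormSq, hiddenAtt_eq, Matrix.mul_apply, hd', ← mul_assoc] using h
  · have h := hW.measure_lower_le_of_indepFun hε0 hε1
      (x := fun ω i => ∑ t, T.hidden ℓ ω i t * u t) (b := fun ω i => ∑ t, T.headOut ℓ ω i t * u t)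
      (by fun_prop) (by fun_prop)
      (hind.comp
        (φ := fun p => (fun i => ∑ t, p.1 i t * u t, fun i => ∑ t, p.2 i t * u t))
        (by fun_prop) measurable_id)
    simp only [hiddenAtt_eq, Matrix.add_mulVec, ← Matrix.mulVec_mulVec, not_le]
    rw [Fintype.card_fin] at h
    exact h

end GaussianInit

end Transformer

end StableRank

namespace StableRank

namespace Transformer

/-! ### Propagation of the bounds through the layers -/

section Propagation

variable {Ω : Type*} {V d nHead k n : ℕ} {T : Transformer Ω V d nHead k n} {q m : ℝ}
  {u : Fin n → ℝ} {j : Fin V} {L : ℕ} {ω : Ω}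

lemma colNormSq_hiddenAtt_le {ℓ : ℕ} (hq0 : 0 < q) (hq1 : q ≤ 1)
    (hA : T.AttentionTypical q u ℓ ω) {R : ℝ} {t : Fin n}
    (hR : q ^ (3 * ℓ + 1) * colNormSq (T.hidden ℓ ω) t ≤ R) :
    q ^ (3 * ℓ + 2) * colNormSq (T.hiddenAtt ℓ ω) t ≤ R + d := by
  have h1 := mul_le_mul_of_nonneg_left (hA.2.1 t) (pow_pos hq0 (3 * ℓ + 1)).le
  have h2 : q ^ (3 * ℓ) * (q * colNormSq (T.headOut ℓ ω) t) ≤ 1 * d :=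
    mul_le_mul (pow_le_one₀ hq0.le hq1) (hA.1 t)
      (mul_nonneg hq0.le (colNormSq_nonneg _ _)) zero_le_one
  rw [show 3 * ℓ + 2 = (3 * ℓ + 1) + 1 by ring, pow_succ, mul_assoc]
  rw [pow_succ] at h1 hR ⊢
  linarith

/-- Keeping the powers of `q` on the left makes the recursion additive: each layer adds `d` from
attention and `d m` from the MLP. Powers of `q` multiplying the added terms are dropped. -/
lemma colNormSq_hidden_le (hk : 0 < k) (hq0 : 0 < q) (hq1 : q ≤ 1)
    (hE : T.EmbeddingTypical q j ω) (hA : ∀ ℓ < L, T.AttentionTypical q u ℓ ω)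
    (hM : ∀ ℓ < L, T.MlpTypical q u ℓ ω) (hB : ∀ ℓ < L, ∀ t, colNormSq (T.B ℓ ω) t ≤ m * k)
    {ℓ : ℕ} (hℓ : ℓ ≤ L) (t : Fin n) :
    q ^ (3 * ℓ + 1) * colNormSq (T.hidden ℓ ω) t ≤ d * (1 + (1 + m) * ℓ) := by
  induction ℓ with
  | zero => simpa using hE.1 t
  | succ ℓ ih =>
    have hk' : (0 : ℝ) < k := by exact_mod_cast hk
    have h1 := colNormSq_hiddenAtt_le hq0 hq1 (hA ℓ hℓ) (ih (Nat.le_of_succ_le hℓ))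
    have h2 := mul_le_mul_of_nonneg_left ((hM ℓ hℓ).1 t) (pow_pos hq0 (3 * ℓ + 2)).le
    have h3 : (k : ℝ)⁻¹ * colNormSq (T.B ℓ ω) t ≤ m := by
      rw [inv_mul_le_iff₀ hk', mul_comm]
      exact hB ℓ hℓ t
    have h4 : q ^ (3 * ℓ + 2) * (d * ((k : ℝ)⁻¹ * colNormSq (T.B ℓ ω) t)) ≤ 1 * (d * m) :=
      mul_le_mul (pow_le_one₀ hq0.le hq1) (by gcongr)
        (by have := colNormSq_nonneg (T.B ℓ ω) t; positivity) zero_le_one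
    -- The recursion itself uses two powers of `q` per layer; the third is slack.
    have h5 : q ^ (3 * (ℓ + 1) + 1) * colNormSq (T.hidden (ℓ + 1) ω) t ≤
        q ^ (3 * ℓ + 2) * (q * colNormSq (T.hidden (ℓ + 1) ω) t) := by
      rw [show 3 * (ℓ + 1) + 1 = (3 * ℓ + 3) + 1 by ring, ← mul_assoc, ← pow_succ]
      exact mul_le_mul_of_nonneg_right (pow_le_pow_of_le_one hq0.le hq1 (Nat.le_succ _))
        (colNormSq_nonneg _ _)
    push_cast
    linarith

lemma mulVec_hiddenAtt_ge {ℓ : ℕ} (hq0 : 0 < q) (hA : T.AttentionTypical q u ℓ ω) {Q : ℝ}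
    (hQ : q ^ (2 * ℓ + 1) * Q ≤ ∑ i, ((T.hidden ℓ ω).mulVec u) i ^ 2) :
    q ^ (2 * ℓ + 2) * Q ≤ ∑ i, ((T.hiddenAtt ℓ ω).mulVec u) i ^ 2 := by
  refine le_trans ?_ hA.2.2
  rw [show 2 * ℓ + 2 = (2 * ℓ + 1) + 1 by ring, pow_succ', mul_assoc]
  exact mul_le_mul_of_nonneg_left hQ hq0.le

/-- One factor `q` is lost to the embedding and one to each of the two sublayers per layer. -/
lemma mulVec_hidden_ge (hq0 : 0 < q) (hA : ∀ ℓ < L, T.AttentionTypical q u ℓ ω)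
    (hM : ∀ ℓ < L, T.MlpTypical q u ℓ ω) {Q : ℝ}
    (hQ : q * Q ≤ ∑ i, ((T.hidden 0 ω).mulVec u) i ^ 2) {ℓ : ℕ} (hℓ : ℓ ≤ L) :
    q ^ (2 * ℓ + 1) * Q ≤ ∑ i, ((T.hidden ℓ ω).mulVec u) i ^ 2 := by
  induction ℓ with
  | zero => simpa using hQ
  | succ ℓ ih =>
    refine le_trans ?_ (hM ℓ hℓ).2
    rw [show 2 * (ℓ + 1) + 1 = (2 * ℓ + 2) + 1 by ring, pow_succ', mul_assoc]
    exact mul_le_mul_of_nonneg_left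
      (mulVec_hiddenAtt_ge hq0 (hA ℓ hℓ) (ih (Nat.le_of_succ_le hℓ))) hq0.le

/-- The test vector: the indicator of the positions of the token `j`. -/
noncomputable def tokenVec (T : Transformer Ω V d nHead k n) (j : Fin V) (t : Fin n) : ℝ :=
  if T.tok t = j then 1 else 0

lemma sum_tokenVec_sq (j : Fin V) :
    ∑ t, T.tokenVec j t ^ 2 = ((Finset.univ.filter fun t => T.tok t = j).card : ℝ) := by
  simp [tokenVec]

/-- The selected columns are identical, so they add coherently; this gives the square of the count.
-/
lemma sum_hidden_zero_mulVec_tokenVec_sq (j : Fin V) :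
    ∑ i, ((T.hidden 0 ω).mulVec (T.tokenVec j)) i ^ 2 =
      ((Finset.univ.filter fun t => T.tok t = j).card : ℝ) ^ 2 * colNormSq (T.E ω) j := by
  have h : ∀ i, ((T.hidden 0 ω).mulVec (T.tokenVec j)) i =
      ((Finset.univ.filter fun t => T.tok t = j).card : ℝ) * T.E ω i j := fun i => by
    simp only [Matrix.mulVec, dotProduct, tokenVec, mul_ite, mul_one, mul_zero, hidden, embedded]
    rw [← Finset.sum_filter, ← nsmul_eq_mul]
    refine Finset.sum_eq_card_nsmul fun t ht => ?_
    rw [(Finset.mem_filter.1 ht).2]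
  simp only [h, mul_pow, colNormSq, Finset.mul_sum]

/-- A stable rank bound from bounds on the column norms and on the image of the test vector. -/
lemma stableRank_rmsNorm_le_of_pow (hd : 0 < d) (hn : 0 < n) {tok : Fin n → Fin V}
    {X : Matrix (Fin d) (Fin n) ℝ} {s r : ℝ} {a b N : ℕ} (hq0 : 0 < q) (hq1 : q ≤ 1)
    (hN : a + b ≤ N) (hqN : 1 ≤ 1.01 * q ^ N) (hr : 0 ≤ r)
    (hs : s = n * pMax tok) (hus : ∑ t, u t ^ 2 = s)
    (hR : ∀ t, q ^ a * colNormSq X t ≤ d * r)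
    (hQ : q ^ b * (s ^ 2 * d) ≤ ∑ i, (X.mulVec u) i ^ 2) :
    stableRank (rmsNorm X) ≤ r * (1.01 / pMax tok) := by
  have hd' : (0 : ℝ) < d := by exact_mod_cast hd
  have hn' : (0 : ℝ) < n := by exact_mod_cast hn
  have hp := pMax_pos hn tok
  have hs0 : 0 < s := hs ▸ mul_pos hn' hp
  have hR' : ∀ t, colNormSq X t ≤ d * r / q ^ a := fun t => by
    rw [le_div_iff₀ (pow_pos hq0 a), mul_comm]
    exact hR t
  refine (stableRank_rmsNorm_le hd hR' (by positivity) hQ).trans ?_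
  have h1 : n * (d * r / q ^ a) * (∑ t, u t ^ 2) / (q ^ b * (s ^ 2 * d)) =
      r / pMax tok / q ^ (a + b) := by
    rw [hus, pow_add, hs]
    field_simp
  have h2 : 1 ≤ 1.01 * q ^ (a + b) :=
    hqN.trans (mul_le_mul_of_nonneg_left (pow_le_pow_of_le_one hq0.le hq1 hN) (by norm_num))
  rw [h1, div_le_iff₀ (pow_pos hq0 _)]
  calc r / pMax tok = r / pMax tok * 1 := (mul_one _).symm
    _ ≤ r / pMax tok * (1.01 * q ^ (a + b)) := by gcongr
    _ = _ := by ring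

/-- On the typical event, all the stable ranks obey linear bounds in the depth. -/
lemma stableRank_bounds_of_typical (hd : 0 < d) (hk : 0 < k) (hn : 0 < n) (hL : 0 < L)
    (hq0 : 0 < q) (hq1 : q ≤ 1) (hqL : 1 ≤ 1.01 * q ^ (7 * L)) (hm : 0 ≤ m)
    (hj : ((Finset.univ.filter fun t => T.tok t = j).card : ℝ) = n * pMax T.tok)
    (hE : T.EmbeddingTypical q j ω) (hA : ∀ ℓ < L, T.AttentionTypical q (T.tokenVec j) ℓ ω)
    (hM : ∀ ℓ < L, T.MlpTypical q (T.tokenVec j) ℓ ω)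
    (hB : ∀ ℓ < L, ∀ t, colNormSq (T.B ℓ ω) t ≤ m * k) :
    stableRank (T.hidden 0 ω) ≤ 1.01 / pMax T.tok ∧
    (∀ ℓ ≤ L, stableRank (T.rms ℓ ω) ≤ (1 + (1 + m) * ℓ) * (1.01 / pMax T.tok)) ∧
    (∀ ℓ < L, stableRank (T.rmsMlp ℓ ω) ≤ (2 + (1 + m) * ℓ) * (1.01 / pMax T.tok)) := by
  have hd' : (0 : ℝ) < d := by exact_mod_cast hd
  have hn' : (0 : ℝ) < n := by exact_mod_cast hn
  have hp := pMax_pos hn T.tok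
  set s : ℝ := ((Finset.univ.filter fun t => T.tok t = j).card : ℝ)
  have hs0 : 0 < s := hj ▸ mul_pos hn' hp
  have hQ0 : q * (s ^ 2 * d) ≤ ∑ i, ((T.hidden 0 ω).mulVec (T.tokenVec j)) i ^ 2 := by
    rw [sum_hidden_zero_mulVec_tokenVec_sq]
    calc q * (s ^ 2 * d) = s ^ 2 * (q * d) := by ring
      _ ≤ _ := mul_le_mul_of_nonneg_left hE.2 (sq_nonneg _)
  have hcol := fun {ℓ : ℕ} (hℓ : ℓ ≤ L) => colNormSq_hidden_le hk hq0 hq1 hE hA hM hB hℓ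
  have hvec := fun {ℓ : ℕ} (hℓ : ℓ ≤ L) => mulVec_hidden_ge hq0 hA hM hQ0 hℓ
  refine ⟨?_, fun ℓ hℓ => ?_, fun ℓ hℓ => ?_⟩
  · have hF : frobSq (T.hidden 0 ω) ≤ n * (d / q) := by
      rw [frobSq_eq_sum_colNormSq]
      calc _ ≤ ∑ _t : Fin n, d / q := Finset.sum_le_sum fun t _ => by
            rw [le_div_iff₀ hq0, mul_comm]
            exact hE.1 t
        _ = _ := by simp
    refine (stableRank_le_of_mulVec hF (by positivity)
      (hQ0.trans (sum_mulVec_sq_le _ _))).trans ?_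
    have h1 : n * (d / q) * (∑ t, T.tokenVec j t ^ 2) / (q * (s ^ 2 * d)) =
        1 / pMax T.tok / q ^ 2 := by
      rw [sum_tokenVec_sq]
      change n * (d / q) * s / (q * (s ^ 2 * d)) = _
      rw [hj]
      field_simp
    have h2 : 1 ≤ 1.01 * q ^ 2 := hqL.trans
      (mul_le_mul_of_nonneg_left (pow_le_pow_of_le_one hq0.le hq1 (by lia)) (by norm_num))
    rw [h1, div_le_iff₀ (by positivity), div_mul_eq_mul_div]
    gcongr
  -- The powers total `(3ℓ + 1) + (2ℓ + 1) = 5ℓ + 2`, which is at most `7L` even at `ℓ = L`, since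
  -- `L ≥ 1`.
  · exact stableRank_rmsNorm_le_of_pow hd hn hq0 hq1 (by lia) hqL (by positivity) hj
      (sum_tokenVec_sq j) (hcol hℓ) (hvec hℓ)
  · refine stableRank_rmsNorm_le_of_pow (a := 3 * ℓ + 2) (b := 2 * ℓ + 2) hd hn hq0 hq1 (by lia)
      hqL (by positivity) hj (sum_tokenVec_sq j) (fun t => ?_)
      (mulVec_hiddenAtt_ge hq0 (hA ℓ hℓ) (hvec hℓ.le))
    refine (colNormSq_hiddenAtt_le hq0 hq1 (hA ℓ hℓ) (hcol hℓ.le t)).trans (le_of_eq ?_)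
    ring

end Propagation

/-! ### Probability of the typical event -/

section Probability

variable {Ω : Type*} [MeasurableSpace Ω] {μ : Measure Ω} [IsProbabilityMeasure μ]
  {V d nHead k n : ℕ} {T : Transformer Ω V d nHead k n} {L : ℕ}

/-- The interface bounds a probability from below, so here measurability is needed to pass to the
complement. -/
lemma GaussianInit.measure_not_propagation_le (hT : T.GaussianInit μ L) {ℓ : ℕ} (hℓ : ℓ < L)
    {Cprop m p : ℝ} (h : PropagationInterface μ (T.hiddenAtt ℓ) (T.B ℓ) Cprop m p) :
    μ.real {ω | ¬ (stableRank (T.B ℓ ω) ≤ Cprop * stableRank (T.rmsMlp ℓ ω) ∧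
      ∀ t, colNormSq (T.B ℓ ω) t ≤ m * k)} ≤ 1 - p := by
  have hB := measurable_stableRank (hT.measurable_B ℓ hℓ)
  have hX := measurable_stableRank (measurable_rmsNorm (hT.measurable_hiddenAtt hℓ))
  have hS : MeasurableSet {ω | stableRank (T.B ℓ ω) ≤ Cprop * stableRank (T.rmsMlp ℓ ω) ∧
      ∀ t, colNormSq (T.B ℓ ω) t ≤ m * k} := by
    refine (measurableSet_le hB (hX.const_mul _)).inter
      (s₂ := {ω | ∀ t, colNormSq (T.B ℓ ω) t ≤ m * k}) ?_
    rw [Set.ofPred_forall]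
    exact MeasurableSet.iInter fun t =>
      measurableSet_le (measurable_colNormSq (hT.measurable_B ℓ hℓ) t) measurable_const
  have h1 := probReal_compl_eq_one_sub (μ := μ) hS
  have h2 := h.prob
  change μ.real {ω | stableRank (T.B ℓ ω) ≤ Cprop * stableRank (T.rmsMlp ℓ ω) ∧
      ∀ t, colNormSq (T.B ℓ ω) t ≤ m * k}ᶜ ≤ 1 - p
  rw [h1]
  exact sub_le_sub_left h2 1

lemma GaussianInit.measure_not_typical_le (hT : T.GaussianInit μ L) {ε : ℝ} (hε0 : 0 ≤ ε)
    (hε1 : ε ≤ 1) (hd : 0 < d) (j : Fin V) (u : Fin n → ℝ) {Cprop m p : ℝ}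
    (h : ∀ ℓ < L, PropagationInterface μ (T.hiddenAtt ℓ) (T.B ℓ) Cprop m p) :
    μ.real {ω | ¬ (T.EmbeddingTypical (1 - ε) j ω ∧ ∀ ℓ : Fin L,
      T.AttentionTypical (1 - ε) u ℓ ω ∧ T.MlpTypical (1 - ε) u ℓ ω ∧
      stableRank (T.B ℓ ω) ≤ Cprop * stableRank (T.rmsMlp ℓ ω) ∧
      ∀ t, colNormSq (T.B ℓ ω) t ≤ m * k)} ≤
    (n + 1) * Real.exp (-(ε ^ 2 * d / 16)) +
      L * ((3 * n + 2) * Real.exp (-(ε ^ 2 * d / 16)) + (1 - p)) := by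
  refine (measureReal_not_and_le _ _).trans
    (add_le_add (hT.measure_not_embeddingTypical_le hε0 hε1 j)
      (measureReal_not_forall_le fun ℓ => ?_))
  have h1 := hT.measure_not_attentionTypical_le hε0 hε1 hd ℓ.2 u
  have h2 := hT.measure_not_mlpTypical_le hε0 hε1 ℓ.2 u
  have h3 := hT.measure_not_propagation_le ℓ.2 (h ℓ ℓ.2)
  refine (measureReal_not_and_le _ _).trans ((add_le_add h1
    ((measureReal_not_and_le _ _).trans (add_le_add h2 h3))).trans (le_of_eq ?_))
  ring

end Probability

end Transformer

/-- The union bound over positions and layers is absorbed by the exponential. -/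
lemma union_bound_le {L n d : ℕ} (hL : 1 ≤ L) (hn : 1 ≤ n)
    (hd : 32000000 * (L : ℝ) ^ 2 * Real.log (n * L) ≤ d) {E : ℝ}
    (hE : E = Real.exp (-((1 / (1000 * (L : ℝ))) ^ 2 * d / 16))) :
    (n + 1) * E + L * ((3 * n + 2) * E) ≤
      32000000 * L * Real.exp (-(1 / 32000000) * (d / (L : ℝ) ^ 2)) := by
  have hL' : (1 : ℝ) ≤ L := by exact_mod_cast hL
  have hn' : (1 : ℝ) ≤ n := by exact_mod_cast hn
  have hL0 : (0 : ℝ) < L := by linarith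
  set x : ℝ := d / (L : ℝ) ^ 2 with hx
  have hlog : Real.log (n * L) ≤ 1 / 32000000 * x := by
    rw [hx, mul_div_assoc', le_div_iff₀ (by positivity)]
    linarith
  have hnL : n * L ≤ Real.exp (1 / 32000000 * x) :=
    (Real.log_le_iff_le_exp (by positivity)).1 hlog
  -- Here `ε² / 16 = 1 / (16000000 L²)`. The exponential is split into two equal factors: one
  -- absorbs `n L`, the other survives in the final bound.
  have hE' : E = Real.exp (-(1 / 32000000 * x)) * Real.exp (-(1 / 32000000 * x)) := by
    rw [hE, ← Real.exp_add, hx]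
    congr 1
    field_simp
    ring
  have h1 : n * L * E ≤ Real.exp (-(1 / 32000000 * x)) := by
    rw [hE', ← mul_assoc]
    refine mul_le_of_le_one_left (Real.exp_pos _).le ?_
    rw [Real.exp_neg]
    exact mul_inv_le_one_of_le₀ hnL (Real.exp_pos _).le
  have hE0 : 0 < E := hE ▸ Real.exp_pos _
  have h2 : (n + 1 + L * (3 * n + 2) : ℝ) ≤ 7 * (n * L) := by nlinarith
  rw [neg_mul]
  have h3 := Real.exp_pos (-(1 / 32000000 * x))
  nlinarith [mul_le_mul_of_nonneg_right h2 hE0.le, mul_le_mul_of_nonneg_right hL' h3.le]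

end StableRank

/-! ### Choice of constants and assembly -/

open StableRank in
theorem mainTheorem4 :
    ∃ c C : ℝ, 0 < c ∧ 0 < C ∧
      ∀ (L nHead d k n V : ℕ), 1 ≤ L → 1 ≤ nHead → 1 ≤ d → 1 ≤ k → 1 ≤ n →
      ∀ (Ω : Type*) [MeasurableSpace Ω] (μ : MeasureTheory.Measure Ω)
        [MeasureTheory.IsProbabilityMeasure μ]
        (T : StableRank.Transformer Ω V d nHead k n), T.GaussianInit μ L →
      ∀ (Cprop m p : ℝ),
        (∀ ℓ < L, StableRank.PropagationInterface μ (T.hiddenAtt ℓ) (T.B ℓ) Cprop m p) →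
      C * (L : ℝ) ^ 2 * Real.log (n * L) ≤ d →
      C * (L : ℝ) ^ 2 * Real.log (n * L) ≤ k →
      ∀ (ρ : ℝ), ρ = 3.1 * (1 + m) →
      1 - C * L * Real.exp (-c * (d / (L : ℝ) ^ 2)) - L * (1 - p) ≤
        μ.real {ω |
          (StableRank.stableRank (T.hidden 0 ω) ≤ 1.01 / StableRank.pMax T.tok ∧
            StableRank.stableRank (T.rms 0 ω) ≤ 1.03 / StableRank.pMax T.tok ∧
            StableRank.stableRank (T.rmsMlp 0 ω) ≤ 6.03 / StableRank.pMax T.tok) ∧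
          (∀ ℓ < L,
            StableRank.stableRank (T.rms ℓ ω) ≤
              (1.02 + 1.02 * (1 + m) * ℓ) * (1.01 / StableRank.pMax T.tok) * ρ ^ ℓ ∧
            StableRank.stableRank (T.rmsMlp ℓ ω) ≤
              (6.13 + 3.09 * (1 + m) * ℓ) * (1.01 / StableRank.pMax T.tok) * ρ ^ ℓ ∧
            StableRank.stableRank (T.B ℓ ω) ≤
              Cprop * (6.13 + 3.09 * (1 + m) * ℓ) * (1.01 / StableRank.pMax T.tok) * ρ ^ ℓ) ∧
          StableRank.stableRank (T.rms L ω) ≤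
            (1.02 + 1.02 * (1 + m) * L) * (1.01 / StableRank.pMax T.tok) * ρ ^ L} := by
  -- `32000000 = 2 · 16 · 1000²`: the tail constant `16`, the factor `1000` in `ε`, and the halving
  -- of the exponent in the union bound.
  refine ⟨1 / 32000000, 32000000, by norm_num, by norm_num, ?_⟩
  intro L nHead d k n V hL _ hd hk hn Ω _ μ _ T hT Cprop m p hprop hdL _ ρ hρ
  have hm : 0 ≤ m := (hprop 0 hL).m_nonneg
  have hC : 0 ≤ Cprop := zero_le_one.trans (hprop 0 hL).one_le_Cprop
  have hL' : (1 : ℝ) ≤ L := by exact_mod_cast hL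
  have hp := pMax_pos hn T.tok
  obtain ⟨j, hj⟩ := exists_card_eq_mul_pMax hn T.tok
  set ε : ℝ := 1 / (1000 * L) with hε
  have hε0 : 0 ≤ ε := by positivity
  have hεL : L * ε = 1 / 1000 := by rw [hε]; field_simp
  have hε1 : ε ≤ 1 / 1000 := by nlinarith
  -- Bernoulli: `(1 - ε)^(7L) ≥ 1 - 7/1000`, and `1.01 · 0.993 > 1`.
  have hqL : 1 ≤ 1.01 * (1 - ε) ^ (7 * L) := by
    have h := one_add_mul_le_pow (a := -ε) (by linarith) (7 * L)
    push_cast at h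
    rw [← sub_eq_add_neg] at h
    linarith
  have hρ1 : ∀ ℓ : ℕ, 1 ≤ ρ ^ ℓ := fun ℓ => one_le_pow₀ (by rw [hρ]; linarith)
  have hbad := hT.measure_not_typical_le hε0 (hε1.trans (by norm_num)) hd j (T.tokenVec j) hprop
  have hunion := union_bound_le hL hn hdL rfl
  refine le_trans (b := 1 - μ.real {ω | ¬ (T.EmbeddingTypical (1 - ε) j ω ∧ ∀ ℓ : Fin L,
      T.AttentionTypical (1 - ε) (T.tokenVec j) ℓ ω ∧ T.MlpTypical (1 - ε) (T.tokenVec j) ℓ ω ∧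
      stableRank (T.B ℓ ω) ≤ Cprop * stableRank (T.rmsMlp ℓ ω) ∧
      ∀ t, colNormSq (T.B ℓ ω) t ≤ m * k)}) (by linarith) ?_
  rw [sub_le_iff_le_add]
  -- The target event and the failure event cover the whole space, so neither needs to be
  -- measurable.
  refine (probReal_univ (μ := μ)).ge.trans (le_trans (measureReal_mono fun ω _ => ?_) (measureReal_union_le _ _))
  rw [Set.mem_union, or_iff_not_imp_right]
  intro hω
  simp only [Set.mem_ofPred_eq, not_not] at hω
  obtain ⟨hE, hlayer⟩ := hω
  obtain ⟨h0, hrms, hmlp⟩ := Transformer.stableRank_bounds_of_typical hd hk hn hL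
    (by linarith) (by linarith) hqL hm hj hE (fun ℓ hℓ => (hlayer ⟨ℓ, hℓ⟩).1)
    (fun ℓ hℓ => (hlayer ⟨ℓ, hℓ⟩).2.1) (fun ℓ hℓ => (hlayer ⟨ℓ, hℓ⟩).2.2.2)
  -- The bounds obtained are linear in `ℓ`; as `ρ ≥ 1`, the factor `ρ ^ ℓ` and the larger numerical
  -- constants only weaken them.
  have hweak : ∀ {a b : ℝ} (ℓ : ℕ), 0 ≤ a → a ≤ b →
      a * (1.01 / pMax T.tok) ≤ b * (1.01 / pMax T.tok) * ρ ^ ℓ := fun ℓ ha hab =>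
    (mul_le_mul_of_nonneg_right hab (by positivity)).trans
      (le_mul_of_one_le_right (mul_nonneg (ha.trans hab) (by positivity)) (hρ1 ℓ))
  have hml : ∀ ℓ : ℕ, 0 ≤ (1 + m) * ℓ := fun ℓ => by positivity
  have hrms' : ∀ ℓ ≤ L, stableRank (T.rms ℓ ω) ≤
      (1.02 + 1.02 * (1 + m) * ℓ) * (1.01 / pMax T.tok) * ρ ^ ℓ := fun ℓ hℓ =>
    (hrms ℓ hℓ).trans (hweak ℓ (by positivity) (by nlinarith [hml ℓ]))
  have hmlp' : ∀ ℓ < L, stableRank (T.rmsMlp ℓ ω) ≤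
      (6.13 + 3.09 * (1 + m) * ℓ) * (1.01 / pMax T.tok) * ρ ^ ℓ := fun ℓ hℓ =>
    (hmlp ℓ hℓ).trans (hweak ℓ (by positivity) (by nlinarith [hml ℓ]))
  refine ⟨⟨h0, ?_, ?_⟩, fun ℓ hℓ => ⟨hrms' ℓ hℓ.le, hmlp' ℓ hℓ, ?_⟩, hrms' L le_rfl⟩
  · refine (hrms 0 (Nat.zero_le L)).trans ?_
    rw [mul_div_assoc']
    gcongr
    norm_num
  · refine (hmlp 0 hL).trans ?_
    rw [mul_div_assoc']
    gcongr
    norm_num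
  · refine (hlayer ⟨ℓ, hℓ⟩).2.2.1.trans ((mul_le_mul_of_nonneg_left (hmlp' ℓ hℓ) hC).trans
      (le_of_eq ?_))
    ring
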